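/- Let $d_\rho=\frac{3+\sqrt{13}}{2}$ and $t=\left(-\frac23 d_\rho+\frac53\right)\sqrt{d_\rho}$. Let $\mathcal H_3$ be the fusion category over $\mathbb C$ with simple objects $1,\alpha,\alpha^*,\rho,{}_\alpha\rho,{}_{\alpha^*}\rho$ and the multiplicity-free fusion rules $\alpha^g\otimes\alpha^h=\alpha^{g+h}$, $\alpha^g\otimes\alpha^h\rho=\alpha^{g+h}\rho$, $\alpha^g\rho\otimes\alpha^h=\alpha^{g-h}\rho$, $\alpha^g\rho\otimes\alpha^h\rho=\alpha^{g-h}\oplus\rho\oplus{}_\alpha\rho\oplus{}_{\alpha^*}\rho$ ($g,h\in\mathbb Z/3$; $\alpha^*=\alpha^2$), in which $\rho$ is the generating object of a trivalent category with loop value $d_\rho$: $\rho$ is self-dual with a cup and a cap (satisfying both zigzag identities) whose closed loop is $d_\rho$, there is a non-zero rotationally invariant vertex $\tau\in\operatorname{Hom}(1,\rho^{\otimes 3})$, and all morphisms between tensor powers of $\rho$ are linear combinations of planar trivalent diagrams in $\tau$. For a choice of non-zero vectors $v_c^{ab}\in\operatorname{Hom}(c,a\otimes b)$, one for each simple $c$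 occurring in $a\otimes b$, with $a,b,c$ simple, the $F$-symbols $(F_u^{xyz})_{jk}$ are the coefficients by which the associator takes the tree $u\to k\otimes z\to(x\otimes y)\otimes z$ to $\sum_j (F_u^{xyz})_{jk}$ times the tree $u\to x\otimes j\to x\otimes(y\otimes z)$. Then the following hold. 1. The vertex $\tau$ can be rescaled by a non-zero complex number so that the bigon is $\sqrt{d_\rho}\,\mathrm{id}_\rho$, and for each such scaling the triangle (three vertices joined pairwise, with three outer legs) equals $t$ times the vertex. 2. For every choice of the vectors $v_c^{ab}$ the $F$-symbols exist, and $$\left(F_\rho^{\rho\rho\rho}\right)_{\rho\rho}=\frac{t}{\sqrt{d_\rho}}=\frac{2-\sqrt{13}}{3}.$$ -/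

import Mathlib

open CategoryTheory MonoidalCategory Limits

universe v u

section Fusion

attribute [local instance] Abelian.hasFiniteBiproducts

/-- A fusion category over `ℂ`: a `ℂ`-linear rigid semisimple monoidal category with
finite-dimensional morphism spaces, simple unit object, and finitely many simple objects up to
isomorphism. -/
class IsFusionCategory (C : Type u) [Category.{v} C] [Abelian C] [Linear ℂ C]
    [MonoidalCategory C] [MonoidalPreadditive C] [MonoidalLinear ℂ C] [RigidCategory C] :
    Prop where
  finiteDimensional_hom : ∀ X Y : C, FiniteDimensional ℂ (X ⟶ Y)
  simple_unit : Simple (𝟙_ C)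
  semisimple : ∀ X : C, ∃ (n : ℕ) (S : Fin n → C),
    (∀ i, Simple (S i)) ∧ Nonempty (X ≅ ⨁ S)
  finite_simples : ∃ (n : ℕ) (S : Fin n → C),
    ∀ X : C, Simple X → ∃ i, Nonempty (X ≅ S i)

end Fusion

/-- The six labels: `pow g` is `α ^ g` and `powRho g` is `α ^ g ρ`, with `g ∈ ℤ/3`; so
`1, α, α*` are `pow 0, pow 1, pow 2` and `ρ, αρ, α*ρ` are `powRho 0, powRho 1, powRho 2`. -/
inductive H3Label : Type
  | pow (g : ZMod 3)
  | powRho (g : ZMod 3)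
  deriving DecidableEq, Fintype

namespace H3Label

/-- The unit label `1`. -/
abbrev one : H3Label := pow 0

/-- The label `ρ`. -/
abbrev rho : H3Label := powRho 0

/-- The fusion rules: `fusion a b` is the set of labels occurring in `a ⊗ b`, all of them with
multiplicity one.  They are
`α^g α^h = α^(g+h)`, `α^g · α^h ρ = α^(g+h) ρ`, `α^g ρ · α^h = α^(g-h) ρ` and
`α^g ρ · α^h ρ = α^(g-h) + ρ + αρ + α*ρ`. -/
def fusion : H3Label → H3Label → Finset H3Label
  | pow g, pow h => {pow (g + h)}
  | pow g, powRho h => {powRho (g + h)}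
  | powRho g, pow h => {powRho (g - h)}
  | powRho g, powRho h => {pow (g - h), powRho 0, powRho 1, powRho 2}

end H3Label

section Diagrams

variable {C : Type u} [Category.{v} C] [MonoidalCategory C]

/-! Planar trivalent diagrams on one self-dual object `X`.  The unoriented strand is `X`, the cup
and the cap are the two morphisms of an exact pairing of `X` with itself (so that both zigzags can
be straightened), and the trivalent vertex is a morphism `τ : 1 ⟶ X ⊗ (X ⊗ X)`. -/

/-- The cup `1 ⟶ X ⊗ X` of a self-duality of `X`. -/
def cup {X : C} (p : ExactPairing X X) : 𝟙_ C ⟶ X ⊗ X :=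
  @ExactPairing.coevaluation C _ _ X X p

/-- The cap `X ⊗ X ⟶ 1` of a self-duality of `X`. -/
def cap {X : C} (p : ExactPairing X X) : X ⊗ X ⟶ 𝟙_ C :=
  @ExactPairing.evaluation C _ _ X X p

/-- The vertex with one leg below and two legs above: the first leg of `τ` is bent down. -/
def splitVertex {X : C} (p : ExactPairing X X) (τ : 𝟙_ C ⟶ X ⊗ (X ⊗ X)) : X ⟶ X ⊗ X :=
  (ρ_ X).inv ≫ X ◁ τ ≫ (α_ X X (X ⊗ X)).inv ≫ cap p ▷ (X ⊗ X) ≫ (λ_ (X ⊗ X)).hom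

/-- The vertex with two legs below and one leg above: the right upper leg of the splitting vertex
is bent down. -/
def mergeVertex {X : C} (p : ExactPairing X X) (τ : 𝟙_ C ⟶ X ⊗ (X ⊗ X)) : X ⊗ X ⟶ X :=
  splitVertex p τ ▷ X ≫ (α_ X X X).hom ≫ X ◁ cap p ≫ (ρ_ X).hom

/-- The vertex `τ` rotated by one click: its first leg is moved around to the last position. -/
def rotateVertex {X : C} (p : ExactPairing X X) (τ : 𝟙_ C ⟶ X ⊗ (X ⊗ X)) :
    𝟙_ C ⟶ X ⊗ (X ⊗ X) :=
  cup p ≫ splitVertex p τ ▷ X ≫ (α_ X X X).hom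

/-- The closed loop. -/
def loopDiagram {X : C} (p : ExactPairing X X) : 𝟙_ C ⟶ 𝟙_ C :=
  cup p ≫ cap p

/-- The bigon: a strand that splits in two strands, which merge again. -/
def bigonDiagram {X : C} (p : ExactPairing X X) (τ : 𝟙_ C ⟶ X ⊗ (X ⊗ X)) : X ⟶ X :=
  splitVertex p τ ≫ mergeVertex p τ

/-- The triangle with one leg below and two legs above: the strand splits in two, both of these
split again, and the two inner strands of the four are joined by a cap. -/
def triangleDiagram {X : C} (p : ExactPairing X X) (τ : 𝟙_ C ⟶ X ⊗ (X ⊗ X)) : X ⟶ X ⊗ X :=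
  splitVertex p τ ≫ (splitVertex p τ ⊗ₘ splitVertex p τ) ≫
    (α_ X X (X ⊗ X)).hom ≫ X ◁ ((α_ X X X).inv ≫ cap p ▷ X ≫ (λ_ X).hom)

/-- Bracketed words in one letter, i.e. the bracketed tensor powers of one object. -/
inductive TensorWord : Type
  | unit
  | letter
  | tensor (A B : TensorWord)

/-- The object of `C` that a word spells, when its letter stands for `X`. -/
def TensorWord.eval (X : C) : TensorWord → C
  | unit => 𝟙_ C
  | letter => X
  | tensor A B => A.eval X ⊗ B.eval X

variable [Preadditive C] [Linear ℂ C]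

/-- `IsDiagramSum p τ f`: the morphism `f` between bracketed tensor powers of `X` is a linear
combination of planar trivalent diagrams, i.e. it is obtained from the cup, the cap, the vertex `τ`
and the structural isomorphisms by composition, tensor products and linear combinations. -/
inductive IsDiagramSum {X : C} (p : ExactPairing X X) (τ : 𝟙_ C ⟶ X ⊗ (X ⊗ X)) :
    ∀ A B : TensorWord, (A.eval X ⟶ B.eval X) → Prop
  | cup : IsDiagramSum p τ .unit (.tensor .letter .letter) (cup p)
  | cap : IsDiagramSum p τ (.tensor .letter .letter) .unit (cap p)
  | vertex : IsDiagramSum p τ .unit (.tensor .letter (.tensor .letter .letter)) τ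
  | id (A : TensorWord) : IsDiagramSum p τ A A (𝟙 (A.eval X))
  | associator_hom (A B D : TensorWord) :
      IsDiagramSum p τ (.tensor (.tensor A B) D) (.tensor A (.tensor B D))
        (α_ (A.eval X) (B.eval X) (D.eval X)).hom
  | associator_inv (A B D : TensorWord) :
      IsDiagramSum p τ (.tensor A (.tensor B D)) (.tensor (.tensor A B) D)
        (α_ (A.eval X) (B.eval X) (D.eval X)).inv
  | leftUnitor_hom (A : TensorWord) :
      IsDiagramSum p τ (.tensor .unit A) A (λ_ (A.eval X)).hom
  | leftUnitor_inv (A : TensorWord) :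
      IsDiagramSum p τ A (.tensor .unit A) (λ_ (A.eval X)).inv
  | rightUnitor_hom (A : TensorWord) :
      IsDiagramSum p τ (.tensor A .unit) A (ρ_ (A.eval X)).hom
  | rightUnitor_inv (A : TensorWord) :
      IsDiagramSum p τ A (.tensor A .unit) (ρ_ (A.eval X)).inv
  | comp (A B D : TensorWord) (f : A.eval X ⟶ B.eval X) (g : B.eval X ⟶ D.eval X) :
      IsDiagramSum p τ A B f → IsDiagramSum p τ B D g → IsDiagramSum p τ A D (f ≫ g)
  | tensor (A B D E : TensorWord) (f : A.eval X ⟶ B.eval X) (g : D.eval X ⟶ E.eval X) :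
      IsDiagramSum p τ A B f → IsDiagramSum p τ D E g →
        IsDiagramSum p τ (.tensor A D) (.tensor B E) (f ⊗ₘ g)
  | add (A B : TensorWord) (f g : A.eval X ⟶ B.eval X) :
      IsDiagramSum p τ A B f → IsDiagramSum p τ A B g → IsDiagramSum p τ A B (f + g)
  | smul (A B : TensorWord) (c : ℂ) (f : A.eval X ⟶ B.eval X) :
      IsDiagramSum p τ A B f → IsDiagramSum p τ A B (c • f)

end Diagrams

section H3

variable (C : Type u) [Category.{v} C] [Abelian C] [Linear ℂ C] [MonoidalCategory C]

/-- The number `d_ρ = (3 + √13) / 2`. -/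
noncomputable def dRho : ℝ := (3 + √13) / 2

/-- The structure of the `H₃` fusion category on a fusion category `C`: representatives of the
simple objects indexed by the six labels, with the fusion rules above, such that `ρ` is the
generating object of a trivalent category with loop value `d_ρ`.  The latter means: `ρ` is
self-dual with loop value `d_ρ`, it has a rotationally invariant trivalent vertex, and every
morphism between tensor powers of `ρ` is a linear combination of planar trivalent diagrams.
The dimensions `0, 1, 1` of `Hom(1, ρ)`, `Hom(1, ρ ⊗ ρ)`, `Hom(1, ρ ⊗ ρ ⊗ ρ)` follow from the fusion
rules. -/
structure H3Structure where
  /-- representatives of the simple objects -/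
  obj : H3Label → C
  simple_obj : ∀ a, Simple (obj a)
  eq_of_iso : ∀ a b, Nonempty (obj a ≅ obj b) → a = b
  exists_iso_of_simple : ∀ X : C, Simple X → ∃ a, Nonempty (X ≅ obj a)
  unit_iso : Nonempty (obj H3Label.one ≅ 𝟙_ C)
  finrank_hom : ∀ a b c, Module.finrank ℂ (obj c ⟶ obj a ⊗ obj b) =
    if c ∈ H3Label.fusion a b then 1 else 0
  /-- the self-duality of `ρ`, that is, the cup and the cap -/
  selfDual : ExactPairing (obj H3Label.rho) (obj H3Label.rho)
  loop_eq : loopDiagram selfDual = (dRho : ℂ) • 𝟙 (𝟙_ C)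
  /-- the trivalent vertex -/
  vertex : 𝟙_ C ⟶ obj H3Label.rho ⊗ (obj H3Label.rho ⊗ obj H3Label.rho)
  vertex_ne_zero : vertex ≠ 0
  rotateVertex_vertex : rotateVertex selfDual vertex = vertex
  generated : ∀ (A B : TensorWord)
    (f : A.eval (obj H3Label.rho) ⟶ B.eval (obj H3Label.rho)),
    IsDiagramSum selfDual vertex A B f

namespace H3Structure

variable {C} (H : H3Structure C)

/-- A choice of one basis vector `v a b c` of the line `V_c^{ab} = Hom(c, a ⊗ b)` for every
admissible triple (for the other triples this space is zero). -/
def IsVertexBasis (v : ∀ a b c : H3Label, H.obj c ⟶ H.obj a ⊗ H.obj b) : Prop :=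
  ∀ a b c, c ∈ H3Label.fusion a b → v a b c ≠ 0

/-- `F x y z u j k` is the entry `(F_u^{xyz})_{jk}` of the `F`-symbols with respect to the vertices
`v`: the associator takes the tree `u → k ⊗ z → (x ⊗ y) ⊗ z` to the sum over `j` of `(F_u^{xyz})_{jk}`
times the tree `u → x ⊗ j → x ⊗ (y ⊗ z)`. -/
def IsFSymbols (v : ∀ a b c : H3Label, H.obj c ⟶ H.obj a ⊗ H.obj b)
    (F : H3Label → H3Label → H3Label → H3Label → H3Label → H3Label → ℂ) : Prop :=
  ∀ x y z u k : H3Label,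
    v k z u ≫ v x y k ▷ H.obj z ≫ (α_ (H.obj x) (H.obj y) (H.obj z)).hom =
      ∑ j : H3Label, F x y z u j k • (v x j u ≫ H.obj x ◁ v y z j)

end H3Structure

end H3

/-- The constant `t = (-(2/3) d_ρ + 5/3) √d_ρ`. -/
noncomputable def tRho : ℝ := (-(2 / 3) * dRho + 5 / 3) * √dRho

/-! Rescaling the vertex by c multiplies the bigon and the ladder (two strands joined by one rung)
by c². So the bigon may be taken to be the identity, and the claim becomes that the ladder L acts on
the summand ρ of ρ ⊗ ρ = 1 + ρ + αρ + α*ρ by (5 − 2d)/3, where d = `dRho`. By Schur, L acts on the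
four summands by scalars 1, t, x, y (`IsSpectrum`); this t is the stated constant divided by √d.

Three relations tie t, x, y together. If x = y held, L would be a combination of the identity,
cap-cup and merge-split; every diagram would then reduce to forests, and all endomorphisms of ρ ⊗ ρ
would lie in the span of these three, which cannot separate αρ from α*ρ. Hence x ≠ y (`ne`). Since L
is quadratic away from 1 and ρ, L² is a combination of L and those three diagrams. A click of
rotation fixes L² and exchanges L with merge-split and the identity with cap-cup, so comparing
coefficients gives two relations (`square_relations`). Crossing with the invertible object α shows
that the idempotents of ρ, αρ and α*ρ have equal partial traces; as L has partial trace zero, 1/d +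
t + x + y = 0 (`trace_relation`). Elimination leaves t = 0 or t = (5 − 2d)/3 (`mul_relation`).

The value t = 0 satisfies all three relations, so finer information is needed. Hom(αρ, ρ ⊗ ρ ⊗ ρ)
has two splittings into three lines, by the channel of the first two and of the last two strands,
and conjugation by α permutes them cyclically in opposite directions. The ladder relation between
the two splittings is a polynomial system (`exists_cyclic_coefficients`) without solution at t = 0
(`cyclic_coefficients_false`).

For the F-symbol, composing the associator identity with a merging vertex isolates the channel ρ and
produces the ladder (`rho_eq`). The basis vector for ρ in ρ ⊗ ρ occurs twice on both sides, so the
choice of gauge cancels. -/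

/-! ### Elementary diagrams acting on the left of an arbitrary object, and straightening of strands.
-/

section Strands

variable {C : Type u} [Category.{v} C] [MonoidalCategory C] {X : C}

/-- The cup to the left of `Z`. -/
def cupApp (p : ExactPairing X X) (Z : C) : Z ⟶ X ⊗ (X ⊗ Z) :=
  (λ_ Z).inv ≫ cup p ▷ Z ≫ (α_ X X Z).hom

/-- The cap to the left of `Z`. -/
def capApp (p : ExactPairing X X) (Z : C) : X ⊗ (X ⊗ Z) ⟶ Z :=
  (α_ X X Z).inv ≫ cap p ▷ Z ≫ (λ_ Z).hom

/-- The splitting vertex to the left of `Z`. -/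
def splitApp (p : ExactPairing X X) (τ : 𝟙_ C ⟶ X ⊗ (X ⊗ X)) (Z : C) :
    X ⊗ Z ⟶ X ⊗ (X ⊗ Z) :=
  splitVertex p τ ▷ Z ≫ (α_ X X Z).hom

/-- The merging vertex to the left of `Z`. -/
def mergeApp (p : ExactPairing X X) (τ : 𝟙_ C ⟶ X ⊗ (X ⊗ X)) (Z : C) :
    X ⊗ (X ⊗ Z) ⟶ X ⊗ Z :=
  (α_ X X Z).inv ≫ mergeVertex p τ ▷ Z

/-- The vertex with three upper legs to the left of `Z`. -/
def vertexApp (τ : 𝟙_ C ⟶ X ⊗ (X ⊗ X)) (Z : C) : Z ⟶ X ⊗ (X ⊗ (X ⊗ Z)) :=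
  (λ_ Z).inv ≫ τ ▷ Z ≫ (α_ X (X ⊗ X) Z).hom ≫ X ◁ (α_ X X Z).hom

/-- An endomorphism of `X ⊗ X` to the left of `Z`. -/
def endApp (f : X ⊗ X ⟶ X ⊗ X) (Z : C) : X ⊗ (X ⊗ Z) ⟶ X ⊗ (X ⊗ Z) :=
  (α_ X X Z).inv ≫ f ▷ Z ≫ (α_ X X Z).hom

variable (p : ExactPairing X X) (τ : 𝟙_ C ⟶ X ⊗ (X ⊗ X))

theorem cupApp_naturality {Z W : C} (f : Z ⟶ W) :
    cupApp p Z ≫ X ◁ X ◁ f = f ≫ cupApp p W :=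
  calc cupApp p Z ≫ X ◁ X ◁ f
      = (λ_ Z).inv ≫ (cup p ▷ Z ≫ (X ⊗ X) ◁ f) ≫ (α_ X X W).hom := by
        simp only [cupApp]; monoidal
    _ = f ≫ cupApp p W := by rw [← whisker_exchange]; simp only [cupApp]; monoidal

theorem capApp_naturality {Z W : C} (f : Z ⟶ W) :
    X ◁ X ◁ f ≫ capApp p W = capApp p Z ≫ f :=
  calc X ◁ X ◁ f ≫ capApp p W
      = (α_ X X Z).inv ≫ ((X ⊗ X) ◁ f ≫ cap p ▷ W) ≫ (λ_ W).hom := by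
        simp only [capApp]; monoidal
    _ = capApp p Z ≫ f := by rw [whisker_exchange]; simp only [capApp]; monoidal

theorem splitApp_naturality {Z W : C} (f : Z ⟶ W) :
    splitApp p τ Z ≫ X ◁ X ◁ f = X ◁ f ≫ splitApp p τ W :=
  calc splitApp p τ Z ≫ X ◁ X ◁ f
      = (splitVertex p τ ▷ Z ≫ (X ⊗ X) ◁ f) ≫ (α_ X X W).hom := by
        simp only [splitApp]; monoidal
    _ = X ◁ f ≫ splitApp p τ W := by rw [← whisker_exchange]; simp only [splitApp]; monoidal

theorem mergeApp_naturality {Z W : C} (f : Z ⟶ W) :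
    X ◁ X ◁ f ≫ mergeApp p τ W = mergeApp p τ Z ≫ X ◁ f :=
  calc X ◁ X ◁ f ≫ mergeApp p τ W
      = (α_ X X Z).inv ≫ ((X ⊗ X) ◁ f ≫ mergeVertex p τ ▷ W) := by
        simp only [mergeApp]; monoidal
    _ = mergeApp p τ Z ≫ X ◁ f := by rw [whisker_exchange]; simp only [mergeApp]; monoidal

theorem endApp_naturality (f : X ⊗ X ⟶ X ⊗ X) {Z W : C} (g : Z ⟶ W) :
    X ◁ X ◁ g ≫ endApp f W = endApp f Z ≫ X ◁ X ◁ g :=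
  calc X ◁ X ◁ g ≫ endApp f W
      = (α_ X X Z).inv ≫ ((X ⊗ X) ◁ g ≫ f ▷ W) ≫ (α_ X X W).hom := by
        simp only [endApp]; monoidal
    _ = endApp f Z ≫ X ◁ X ◁ g := by rw [whisker_exchange]; simp only [endApp]; monoidal

theorem endApp_comp (f g : X ⊗ X ⟶ X ⊗ X) (Z : C) :
    endApp (f ≫ g) Z = endApp f Z ≫ endApp g Z := by
  simp [endApp]

theorem endApp_id (Z : C) : endApp (𝟙 (X ⊗ X)) Z = 𝟙 _ := by
  simp [endApp]

theorem cupApp_capApp_right (Z : C) : X ◁ cupApp p Z ≫ capApp p (X ⊗ Z) = 𝟙 _ := by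
  have h : X ◁ cup p ≫ (α_ X X X).inv ≫ cap p ▷ X = (ρ_ X).hom ≫ (λ_ X).inv :=
    @ExactPairing.coevaluation_evaluation C _ _ X X p
  calc X ◁ cupApp p Z ≫ capApp p (X ⊗ Z)
      = 𝟙 _ ⊗≫ (X ◁ cup p ≫ (α_ X X X).inv ≫ cap p ▷ X) ▷ Z ⊗≫ 𝟙 _ := by
        simp only [cupApp, capApp]; monoidal
    _ = 𝟙 _ := by rw [h]; monoidal

theorem cupApp_capApp_left (Z : C) : cupApp p (X ⊗ Z) ≫ X ◁ capApp p Z = 𝟙 _ := by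
  have h : cup p ▷ X ≫ (α_ X X X).hom ≫ X ◁ cap p = (λ_ X).hom ≫ (ρ_ X).inv :=
    @ExactPairing.evaluation_coevaluation C _ _ X X p
  calc cupApp p (X ⊗ Z) ≫ X ◁ capApp p Z
      = 𝟙 _ ⊗≫ (cup p ▷ X ≫ (α_ X X X).hom ≫ X ◁ cap p) ▷ Z ⊗≫ 𝟙 _ := by
        simp only [cupApp, capApp]; monoidal
    _ = 𝟙 _ := by rw [h]; monoidal

theorem splitApp_eq (Z : C) :
    splitApp p τ Z = X ◁ vertexApp τ Z ≫ capApp p (X ⊗ (X ⊗ Z)) := by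
  simp only [splitApp, splitVertex, vertexApp, capApp]; monoidal

theorem mergeApp_eq (Z : C) :
    mergeApp p τ Z = splitApp p τ (X ⊗ Z) ≫ X ◁ capApp p Z := by
  simp only [mergeApp, splitApp, mergeVertex, capApp]; monoidal

theorem cupApp_splitApp (Z : C) :
    cupApp p Z ≫ splitApp p τ (X ⊗ Z) = vertexApp (rotateVertex p τ) Z := by
  simp only [cupApp, splitApp, rotateVertex, vertexApp]; monoidal

theorem cupApp_whiskerLeft_splitApp (Z : C) :
    cupApp p Z ≫ X ◁ splitApp p τ Z = vertexApp τ Z := by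
  rw [splitApp_eq, whiskerLeft_comp, reassoc_of% (cupApp_naturality p (vertexApp τ Z)),
    cupApp_capApp_left, Category.comp_id]

end Strands

/-! ### The ladder and rotation by one click. -/

section Rotation

variable {C : Type u} [Category.{v} C] [MonoidalCategory C] {X : C}

/-- The ladder with one rung, to the left of `Z`. -/
def ladderApp (p : ExactPairing X X) (τ : 𝟙_ C ⟶ X ⊗ (X ⊗ X)) (Z : C) :
    X ⊗ (X ⊗ Z) ⟶ X ⊗ (X ⊗ Z) :=
  splitApp p τ (X ⊗ Z) ≫ X ◁ mergeApp p τ Z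

/-- The ladder with one rung. -/
def ladder (p : ExactPairing X X) (τ : 𝟙_ C ⟶ X ⊗ (X ⊗ X)) : X ⊗ X ⟶ X ⊗ X :=
  splitVertex p τ ▷ X ≫ (α_ X X X).hom ≫ X ◁ mergeVertex p τ

variable (p : ExactPairing X X) (τ : 𝟙_ C ⟶ X ⊗ (X ⊗ X))

theorem endApp_ladder (Z : C) : endApp (ladder p τ) Z = ladderApp p τ Z := by
  simp only [endApp, ladder, ladderApp, splitApp, mergeApp]; monoidal

theorem endApp_cap_cup (Z : C) : endApp (cap p ≫ cup p) Z = capApp p Z ≫ cupApp p Z := by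
  simp [endApp, capApp, cupApp]

theorem endApp_merge_split (Z : C) :
    endApp (mergeVertex p τ ≫ splitVertex p τ) Z = mergeApp p τ Z ≫ splitApp p τ Z := by
  simp [endApp, mergeApp, splitApp]

theorem splitApp_eq_bend_right (Z : C) :
    splitApp p τ Z = X ◁ cupApp p Z ≫ mergeApp p τ (X ⊗ Z) := by
  rw [mergeApp_eq, ← reassoc_of% (splitApp_naturality p τ (cupApp p Z)), ← whiskerLeft_comp,
    cupApp_capApp_right, whiskerLeft_id, Category.comp_id]

variable {p τ}

/-- Rotation invariance in usable form: a splitting vertex slides along a cup from one leg to the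
other. -/
theorem cupApp_splitApp_eq (h : rotateVertex p τ = τ) (Z : C) :
    cupApp p Z ≫ splitApp p τ (X ⊗ Z) = cupApp p Z ≫ X ◁ splitApp p τ Z := by
  rw [cupApp_splitApp, cupApp_whiskerLeft_splitApp, h]

/-- The merging vertex may also be obtained by bending down the left leg of the splitting vertex. -/
theorem mergeApp_eq_bend_left (h : rotateVertex p τ = τ) (Z : C) :
    mergeApp p τ Z = X ◁ splitApp p τ Z ≫ capApp p (X ⊗ Z) := by
  have hs : ∀ W, splitApp p τ W = X ◁ cupApp p W ≫ X ◁ splitApp p τ (X ⊗ W) ≫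
      capApp p (X ⊗ (X ⊗ W)) := fun W => by
    rw [← whiskerLeft_comp_assoc, cupApp_splitApp_eq h, whiskerLeft_comp, Category.assoc,
      capApp_naturality, ← Category.assoc, cupApp_capApp_right, Category.id_comp]
  rw [mergeApp_eq, hs, Category.assoc, Category.assoc, ← capApp_naturality,
    ← whiskerLeft_comp_assoc, ← whiskerLeft_comp_assoc, Category.assoc, splitApp_naturality,
    reassoc_of% (cupApp_capApp_left p Z)]

/-- The rung of a ladder may slope either way, because the merging vertex is obtained by bending
either leg of the splitting vertex. -/
theorem ladderApp_eq (h : rotateVertex p τ = τ) (Z : C) :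
    ladderApp p τ Z = X ◁ splitApp p τ Z ≫ mergeApp p τ (X ⊗ Z) := by
  rw [ladderApp, mergeApp_eq_bend_left h, whiskerLeft_comp, mergeApp_eq p τ (X ⊗ Z),
    reassoc_of% (splitApp_naturality p τ (splitApp p τ Z))]

theorem splitApp_eq_bend_left (h : rotateVertex p τ = τ) (Z : C) :
    splitApp p τ Z = cupApp p (X ⊗ Z) ≫ X ◁ mergeApp p τ Z := by
  rw [mergeApp_eq_bend_left h, whiskerLeft_comp, reassoc_of% (cupApp_naturality p (splitApp p τ Z)),
    cupApp_capApp_left, Category.comp_id]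

theorem mergeApp_capApp (h : rotateVertex p τ = τ) (Z : C) :
    mergeApp p τ (X ⊗ Z) ≫ capApp p Z = X ◁ mergeApp p τ Z ≫ capApp p Z := by
  rw [mergeApp_eq_bend_left h (X ⊗ Z), mergeApp_eq, whiskerLeft_comp, Category.assoc,
    Category.assoc, capApp_naturality]

theorem ladderApp_whiskerLeft_capApp (h : rotateVertex p τ = τ) (Z : C) :
    ladderApp p τ (X ⊗ Z) ≫ X ◁ capApp p Z = X ◁ mergeApp p τ Z ≫ mergeApp p τ Z := by
  rw [ladderApp, Category.assoc, ← whiskerLeft_comp, mergeApp_capApp h, whiskerLeft_comp,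
    reassoc_of% (splitApp_naturality p τ (mergeApp p τ Z)), ← mergeApp_eq]

theorem cupApp_whiskerLeft_ladderApp (h : rotateVertex p τ = τ) (Z : C) :
    cupApp p (X ⊗ Z) ≫ X ◁ ladderApp p τ Z = splitApp p τ Z ≫ splitApp p τ (X ⊗ Z) := by
  rw [ladderApp_eq h, whiskerLeft_comp, reassoc_of% (cupApp_naturality p (splitApp p τ Z)),
    ← splitApp_eq_bend_left h]

variable (p) in
/-- Rotation by one click of a natural endomorphism of `X ⊗ (X ⊗ -)`. -/
def rotateApp (f : X ⊗ X ⟶ X ⊗ X) (Z : C) : X ⊗ (X ⊗ Z) ⟶ X ⊗ (X ⊗ Z) :=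
  cupApp p (X ⊗ (X ⊗ Z)) ≫ X ◁ endApp f (X ⊗ Z) ≫ X ◁ X ◁ capApp p Z

theorem rotateApp_id (Z : C) : rotateApp p (𝟙 (X ⊗ X)) Z = endApp (cap p ≫ cup p) Z := by
  rw [rotateApp, endApp_id, whiskerLeft_id, Category.id_comp, cupApp_naturality, endApp_cap_cup]

theorem rotateApp_cap_cup (Z : C) : rotateApp p (cap p ≫ cup p) Z = 𝟙 _ := by
  rw [rotateApp, endApp_cap_cup, whiskerLeft_comp, Category.assoc,
    reassoc_of% (cupApp_capApp_left p (X ⊗ Z)), ← whiskerLeft_comp, cupApp_capApp_left,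
    whiskerLeft_id]

theorem rotateApp_merge_split (h : rotateVertex p τ = τ) (Z : C) :
    rotateApp p (mergeVertex p τ ≫ splitVertex p τ) Z = endApp (ladder p τ) Z := by
  rw [rotateApp, endApp_merge_split, whiskerLeft_comp, Category.assoc,
    ← reassoc_of% (splitApp_eq_bend_left h (X ⊗ Z)), ← whiskerLeft_comp, ← mergeApp_eq,
    endApp_ladder, ladderApp]

theorem rotateApp_ladder (h : rotateVertex p τ = τ) (Z : C) :
    rotateApp p (ladder p τ) Z = endApp (mergeVertex p τ ≫ splitVertex p τ) Z := by
  rw [rotateApp, endApp_ladder, reassoc_of% (cupApp_whiskerLeft_ladderApp h (X ⊗ Z)),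
    splitApp_naturality, ← Category.assoc, ← mergeApp_eq, endApp_merge_split]

/-- The square is invariant under rotation by one click. -/
theorem rotateApp_ladder_ladder (h : rotateVertex p τ = τ) (Z : C) :
    rotateApp p (ladder p τ ≫ ladder p τ) Z = endApp (ladder p τ ≫ ladder p τ) Z := by
  rw [rotateApp, endApp_comp, endApp_comp, endApp_ladder, endApp_ladder, whiskerLeft_comp,
    Category.assoc, reassoc_of% (cupApp_whiskerLeft_ladderApp h (X ⊗ Z)), ← whiskerLeft_comp,
    ladderApp_whiskerLeft_capApp h, whiskerLeft_comp,
    reassoc_of% (splitApp_naturality p τ (mergeApp p τ Z)),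
    ladderApp, Category.assoc]

/-- The inner cap of the triangle bends the left leg of the right-hand vertex, which turns that
vertex into a merge. -/
theorem triangleDiagram_eq (h : rotateVertex p τ = τ) :
    triangleDiagram p τ = splitVertex p τ ≫ ladder p τ := by
  have hm : mergeVertex p τ = X ◁ splitVertex p τ ≫ (α_ X X X).inv ≫ cap p ▷ X ≫ (λ_ X).hom :=
    calc mergeVertex p τ = X ◁ (ρ_ X).inv ≫ mergeApp p τ (𝟙_ C) ≫ (ρ_ X).hom := by
          simp only [mergeApp]; monoidal
      _ = _ := by
          rw [mergeApp_eq_bend_left h]; simp only [splitApp, capApp]; monoidal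
  rw [triangleDiagram, ladder, hm, MonoidalCategory.tensorHom_def]
  monoidal

end Rotation

/-! ### Layered diagrams and removal of caps and merges by skein relations. -/

section Generation

variable {C : Type u} [Category.{v} C] [MonoidalCategory C]

/-- `n` strands `X` to the left of `Z`, bracketed to the right. -/
@[reducible]
def strands (X Z : C) : ℕ → C
  | 0 => Z
  | n + 1 => X ⊗ strands X Z n

variable {X : C} (p : ExactPairing X X) (τ : 𝟙_ C ⟶ X ⊗ (X ⊗ X)) (Z : C)

/-- The diagrams that consist of vertical strands and either one cup or one splitting vertex. -/
inductive IsUpStep : ∀ n m : ℕ, (strands X Z n ⟶ strands X Z m) → Prop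
  | cup (n : ℕ) : IsUpStep n (n + 2) (cupApp p (strands X Z n))
  | split (n : ℕ) : IsUpStep (n + 1) (n + 2) (splitApp p τ (strands X Z n))
  | whisker (n m : ℕ) (g : strands X Z n ⟶ strands X Z m) :
      IsUpStep n m g → IsUpStep (n + 1) (m + 1) (X ◁ g)

/-- The diagrams that consist of vertical strands and either one cap or one merging vertex. -/
inductive IsDownStep : ∀ n m : ℕ, (strands X Z n ⟶ strands X Z m) → Prop
  | cap (n : ℕ) : IsDownStep (n + 2) n (capApp p (strands X Z n))
  | merge (n : ℕ) : IsDownStep (n + 2) (n + 1) (mergeApp p τ (strands X Z n))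
  | whisker (n m : ℕ) (g : strands X Z n ⟶ strands X Z m) :
      IsDownStep n m g → IsDownStep (n + 1) (m + 1) (X ◁ g)

variable [Preadditive C] [Linear ℂ C]

/-- Linear combinations of layered diagrams. -/
inductive IsLayered : ∀ n m : ℕ, (strands X Z n ⟶ strands X Z m) → Prop
  | id (n : ℕ) : IsLayered n n (𝟙 _)
  | up (n m : ℕ) (g : strands X Z n ⟶ strands X Z m) : IsUpStep p τ Z n m g → IsLayered n m g
  | down (n m : ℕ) (g : strands X Z n ⟶ strands X Z m) : IsDownStep p τ Z n m g → IsLayered n m g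
  | comp (n m k : ℕ) (g : strands X Z n ⟶ strands X Z m) (h : strands X Z m ⟶ strands X Z k) :
      IsLayered n m g → IsLayered m k h → IsLayered n k (g ≫ h)
  | add (n m : ℕ) (g h : strands X Z n ⟶ strands X Z m) :
      IsLayered n m g → IsLayered n m h → IsLayered n m (g + h)
  | smul (n m : ℕ) (c : ℂ) (g : strands X Z n ⟶ strands X Z m) :
      IsLayered n m g → IsLayered n m (c • g)

/-- Linear combinations of diagrams with at most one cap or merging vertex, followed by at most one
cup or splitting vertex. -/
inductive IsDownUp : ∀ n m : ℕ, (strands X Z n ⟶ strands X Z m) → Prop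
  | id (n : ℕ) : IsDownUp n n (𝟙 (strands X Z n))
  | up (n m : ℕ) (g : strands X Z n ⟶ strands X Z m) : IsUpStep p τ Z n m g → IsDownUp n m g
  | down (n m : ℕ) (g : strands X Z n ⟶ strands X Z m) : IsDownStep p τ Z n m g → IsDownUp n m g
  | down_up (n m k : ℕ) (g : strands X Z n ⟶ strands X Z m) (h : strands X Z m ⟶ strands X Z k) :
      IsDownStep p τ Z n m g → IsUpStep p τ Z m k h → IsDownUp n k (g ≫ h)
  | add (n m : ℕ) (g h : strands X Z n ⟶ strands X Z m) :
      IsDownUp n m g → IsDownUp n m h → IsDownUp n m (g + h)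
  | smul (n m : ℕ) (c : ℂ) (g : strands X Z n ⟶ strands X Z m) :
      IsDownUp n m g → IsDownUp n m (c • g)
  | zero (n m : ℕ) : IsDownUp n m (0 : strands X Z n ⟶ strands X Z m)

/-- Linear combinations of forests: diagrams without caps and merging vertices, and without lower
boundary points. -/
inductive IsForest : ∀ n : ℕ, (Z ⟶ strands X Z n) → Prop
  | id : IsForest 0 (𝟙 Z)
  | up (n m : ℕ) (w : Z ⟶ strands X Z n) (g : strands X Z n ⟶ strands X Z m) :
      IsForest n w → IsUpStep p τ Z n m g → IsForest m (w ≫ g)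
  | add (n : ℕ) (w w' : Z ⟶ strands X Z n) : IsForest n w → IsForest n w' → IsForest n (w + w')
  | smul (n : ℕ) (c : ℂ) (w : Z ⟶ strands X Z n) : IsForest n w → IsForest n (c • w)
  | zero (n : ℕ) : IsForest n 0

variable {p τ Z}

variable (p τ) in
/-- The skein relations that remove every cap and every merging vertex from a diagram without lower
boundary points. -/
structure HasForestSkein (d a b c : ℂ) : Prop where
  rotate : rotateVertex p τ = τ
  bigon : ∀ W, splitApp p τ W ≫ mergeApp p τ W = 𝟙 _
  loop : ∀ W, cupApp p W ≫ capApp p W = d • 𝟙 _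
  split_cap : ∀ W, splitApp p τ W ≫ capApp p W = 0
  cup_merge : ∀ W, cupApp p W ≫ mergeApp p τ W = 0
  ladder_eq : ∀ W, ladderApp p τ W =
    a • 𝟙 _ + b • (capApp p W ≫ cupApp p W) + c • (mergeApp p τ W ≫ splitApp p τ W)

variable {d a b c : ℂ}

theorem HasForestSkein.ladder (S : HasForestSkein p τ d a b c) (n : ℕ) :
    IsDownUp p τ Z (n + 2) (n + 2) (ladderApp p τ (strands X Z n)) := by
  rw [S.ladder_eq]
  exact .add _ _ _ _ (.add _ _ _ _ (.smul _ _ _ _ (.id _))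
    (.smul _ _ _ _ (.down_up _ _ _ _ _ (.cap n) (.cup n))))
    (.smul _ _ _ _ (.down_up _ _ _ _ _ (.merge n) (.split n)))

variable [MonoidalPreadditive C] [MonoidalLinear ℂ C]

theorem IsLayered.whisker {n m : ℕ} {g : strands X Z n ⟶ strands X Z m}
    (hg : IsLayered p τ Z n m g) : IsLayered p τ Z (n + 1) (m + 1) (X ◁ g) := by
  induction hg with
  | id n => rw [whiskerLeft_id]; exact .id (n + 1)
  | up n m g h => exact .up _ _ _ (.whisker _ _ _ h)
  | down n m g h => exact .down _ _ _ (.whisker _ _ _ h)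
  | comp n m k g h _ _ ih ih' => rw [whiskerLeft_comp]; exact .comp _ _ _ _ _ ih ih'
  | add n m g h _ _ ih ih' => rw [MonoidalPreadditive.whiskerLeft_add]; exact .add _ _ _ _ ih ih'
  | smul n m c g _ ih => rw [MonoidalLinear.whiskerLeft_smul]; exact .smul _ _ _ _ ih

theorem IsDownUp.whisker {n m : ℕ} {g : strands X Z n ⟶ strands X Z m}
    (hg : IsDownUp p τ Z n m g) : IsDownUp p τ Z (n + 1) (m + 1) (X ◁ g) := by
  induction hg with
  | id => rw [whiskerLeft_id]; exact .id _
  | up m g h => exact .up _ _ _ (.whisker _ _ _ h)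
  | down m g h => exact .down _ _ _ (.whisker _ _ _ h)
  | down_up m k g h hg hh =>
    rw [whiskerLeft_comp]; exact .down_up _ _ _ _ _ (.whisker _ _ _ hg) (.whisker _ _ _ hh)
  | add m g h _ _ ih ih' => rw [MonoidalPreadditive.whiskerLeft_add]; exact .add _ _ _ _ ih ih'
  | smul m c g _ ih => rw [MonoidalLinear.whiskerLeft_smul]; exact .smul _ _ _ _ ih
  | zero m => rw [MonoidalPreadditive.whiskerLeft_zero]; exact .zero _ _

/-- Two adjacent pieces are either disjoint, and then commute by naturality, or they form a loop, a
lollipop, a bent strand or vertex, a bigon or a ladder. Each of these is rewritten with at most one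
down step, which comes before the up step. -/
theorem IsUpStep.comp_down (S : HasForestSkein p τ d a b c) {n m : ℕ}
    {g : strands X Z n ⟶ strands X Z m} (hg : IsUpStep p τ Z n m g) :
    ∀ {k : ℕ} {h : strands X Z m ⟶ strands X Z k}, IsDownStep p τ Z m k h →
      IsDownUp p τ Z n k (g ≫ h) := by
  induction hg with
  | cup n =>
    intro k h hh
    cases hh with
    | cap => rw [S.loop]; exact .smul _ _ _ _ (.id n)
    | merge => rw [S.cup_merge]; exact .zero _ _
    | whisker _ m h hh =>
      cases hh with
      | cap => exact (cupApp_capApp_left p (strands X Z m)) ▸ .id _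
      | merge =>
        rename_i k
        exact (splitApp_eq_bend_left S.rotate (strands X Z k)) ▸ .up _ _ _ (.split k)
      | whisker _ m h hh =>
        rw [cupApp_naturality]; exact .down_up _ _ _ _ _ hh (.cup m)
  | split n =>
    intro k h hh
    cases hh with
    | cap => rw [S.split_cap]; exact .zero _ _
    | merge => rw [S.bigon]; exact .id (n + 1)
    | whisker _ m h hh =>
      cases hh with
      | cap => exact (mergeApp_eq p τ (strands X Z m)) ▸ .down _ _ _ (.merge m)
      | merge => exact S.ladder _
      | whisker _ m h hh =>
        rw [splitApp_naturality]
        exact .down_up _ _ _ _ _ (.whisker _ _ _ hh) (.split m)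
  | whisker n m g hg ih =>
    intro k h hh
    cases hh with
    | cap k =>
      cases hg with
      | cup n => exact (cupApp_capApp_right p (strands X Z n)) ▸ .id _
      | split n =>
        exact (mergeApp_eq_bend_left S.rotate (strands X Z n)) ▸ .down _ _ _ (.merge n)
      | whisker n _ g hg =>
        rw [capApp_naturality]; exact .down_up _ _ _ _ _ (.cap n) hg
    | merge k =>
      cases hg with
      | cup n => exact (splitApp_eq_bend_right p τ (strands X Z n)) ▸ .up _ _ _ (.split n)
      | split n => exact (ladderApp_eq S.rotate (strands X Z n)) ▸ S.ladder n
      | whisker n _ g hg =>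
        rw [mergeApp_naturality]; exact .down_up _ _ _ _ _ (.merge n) (.whisker _ _ _ hg)
    | whisker _ k h hh => rw [← whiskerLeft_comp]; exact (ih hh).whisker

/-- The down step is pushed below the last layer of the forest, and induction on the forest absorbs
it. It cannot survive at the bottom, where there are no strands to join. -/
theorem IsForest.comp_down (S : HasForestSkein p τ d a b c) {n : ℕ} {w : Z ⟶ strands X Z n}
    (hw : IsForest p τ Z n w) : ∀ {m : ℕ} {h : strands X Z n ⟶ strands X Z m},
      IsDownStep p τ Z n m h → IsForest p τ Z m (w ≫ h) := by
  induction hw with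
  | id => intro m h hh; cases hh
  | up n k w g hw hg ih =>
    intro m h hh
    rw [Category.assoc]
    have := hg.comp_down S hh
    generalize g ≫ h = f at this
    clear hh hg h g
    induction this with
    | id => rw [Category.comp_id]; exact hw
    | up m g hg => exact .up _ _ _ _ hw hg
    | down m g hg => exact ih hg
    | down_up m k g h hg hh => rw [← Category.assoc]; exact .up _ _ _ _ (ih hg) hh
    | add m g h _ _ ih₁ ih₂ =>
      rw [Preadditive.comp_add]; exact .add _ _ _ (ih₁) (ih₂)
    | smul m c g _ ih₁ => rw [Linear.comp_smul]; exact .smul _ _ _ (ih₁)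
    | zero m => rw [comp_zero]; exact .zero _
  | add n w w' _ _ ih ih' =>
    intro m h hh; rw [Preadditive.add_comp]; exact .add _ _ _ (ih hh) (ih' hh)
  | smul n c w _ ih => intro m h hh; rw [Linear.smul_comp]; exact .smul _ _ _ (ih hh)
  | zero n => intro m h hh; rw [zero_comp]; exact .zero _

theorem IsForest.comp (S : HasForestSkein p τ d a b c) {n m : ℕ}
    {g : strands X Z n ⟶ strands X Z m} (hg : IsLayered p τ Z n m g) :
    ∀ {w : Z ⟶ strands X Z n}, IsForest p τ Z n w → IsForest p τ Z m (w ≫ g) := by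
  induction hg with
  | id n => intro w hw; rw [Category.comp_id]; exact hw
  | up n m g h => exact fun hw => .up _ _ _ _ hw h
  | down n m g h => exact fun hw => hw.comp_down S h
  | comp n m k g h _ _ ih ih' => intro w hw; rw [← Category.assoc]; exact ih' (ih hw)
  | add n m g h _ _ ih ih' => intro w hw; rw [Preadditive.comp_add]; exact .add _ _ _ (ih hw) (ih' hw)
  | smul n m c g _ ih => intro w hw; rw [Linear.comp_smul]; exact .smul _ _ _ (ih hw)

end Generation

/-! ### From bracketed words to right-bracketed strands. -/

/-- The number of strands after a word is put to the left of `n` strands. -/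
def TensorWord.shift : TensorWord → ℕ → ℕ
  | .unit, n => n
  | .letter, n => n + 1
  | .tensor A B, n => A.shift (B.shift n)

section Words

variable {C : Type u} [Category.{v} C] [MonoidalCategory C]

/-- Rebracketing of a word to the left of `n` strands. -/
def TensorWord.strandsIso (X Z : C) : ∀ (A : TensorWord) (n : ℕ),
    A.eval X ⊗ strands X Z n ≅ strands X Z (A.shift n)
  | .unit, n => λ_ (strands X Z n)
  | .letter, n => Iso.refl (X ⊗ strands X Z n)
  | .tensor A B, n => α_ (A.eval X) (B.eval X) (strands X Z n) ≪≫
      whiskerLeftIso (A.eval X) (B.strandsIso X Z n) ≪≫ A.strandsIso X Z (B.shift n)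

/-- A morphism between words, to the left of `n` strands. -/
def TensorWord.app {X : C} (Z : C) {A B : TensorWord} (f : A.eval X ⟶ B.eval X) (n : ℕ) :
    strands X Z (A.shift n) ⟶ strands X Z (B.shift n) :=
  (A.strandsIso X Z n).inv ≫ f ▷ strands X Z n ≫ (B.strandsIso X Z n).hom

variable {X : C} {p : ExactPairing X X} {τ : 𝟙_ C ⟶ X ⊗ (X ⊗ X)} {Z : C}
  [Preadditive C] [Linear ℂ C] [MonoidalPreadditive C] [MonoidalLinear ℂ C]

theorem IsLayered.whisker_word (A : TensorWord) {n m : ℕ} {g : strands X Z n ⟶ strands X Z m}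
    (hg : IsLayered p τ Z n m g) : IsLayered p τ Z (A.shift n) (A.shift m)
      ((A.strandsIso X Z n).inv ≫ A.eval X ◁ g ≫ (A.strandsIso X Z m).hom) := by
  induction A generalizing n m with
  | unit =>
    have : (λ_ (strands X Z n)).inv ≫ 𝟙_ C ◁ g ≫ (λ_ (strands X Z m)).hom = g := by simp
    exact this.symm ▸ hg
  | letter =>
    have : 𝟙 (X ⊗ strands X Z n) ≫ X ◁ g ≫ 𝟙 (X ⊗ strands X Z m) = X ◁ g := by simp
    exact this.symm ▸ hg.whisker
  | tensor A B ihA ihB =>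
    have h := ihA (ihB hg)
    have e : (A.strandsIso X Z (B.shift n)).inv ≫ A.eval X ◁ ((B.strandsIso X Z n).inv ≫
        B.eval X ◁ g ≫ (B.strandsIso X Z m).hom) ≫ (A.strandsIso X Z (B.shift m)).hom =
        ((α_ (A.eval X) (B.eval X) (strands X Z n) ≪≫
          whiskerLeftIso (A.eval X) (B.strandsIso X Z n) ≪≫ A.strandsIso X Z (B.shift n))).inv ≫
          (A.eval X ⊗ B.eval X) ◁ g ≫ ((α_ (A.eval X) (B.eval X) (strands X Z m) ≪≫
          whiskerLeftIso (A.eval X) (B.strandsIso X Z m) ≪≫ A.strandsIso X Z (B.shift m))).hom := by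
      simp
    exact e ▸ h

/-- After rebracketing to the right all associators and unitors become identities. The three-legged
vertex is a cup followed by a split, where rotation invariance is used. -/
theorem IsLayered.of_isDiagramSum (hτ : rotateVertex p τ = τ) {A B : TensorWord}
    {f : A.eval X ⟶ B.eval X} (hf : IsDiagramSum p τ A B f) (n : ℕ) :
    IsLayered p τ Z (A.shift n) (B.shift n) (TensorWord.app Z f n) := by
  have key : ∀ {a b : ℕ} {f g : strands X Z a ⟶ strands X Z b}, f = g → IsLayered p τ Z a b g →
    IsLayered p τ Z a b f := fun h h' => h ▸ h'
  induction hf generalizing n with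
  | cup =>
    have e : ∀ W : C, (λ_ W).inv ≫ cup p ▷ W ≫
        (α_ X X W ≪≫ whiskerLeftIso X (Iso.refl (X ⊗ W)) ≪≫ Iso.refl (X ⊗ (X ⊗ W))).hom =
        cupApp p W := fun W => by simp [cupApp]
    exact key (e (strands X Z n)) (.up _ _ _ (.cup n))
  | cap =>
    have e : ∀ W : C, (α_ X X W ≪≫ whiskerLeftIso X (Iso.refl (X ⊗ W)) ≪≫
        Iso.refl (X ⊗ (X ⊗ W))).inv ≫ cap p ▷ W ≫ (λ_ W).hom = capApp p W :=
      fun W => by simp [capApp]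
    exact key (e (strands X Z n)) (.down _ _ _ (.cap n))
  | vertex =>
    have e : ∀ W : C, (λ_ W).inv ≫ τ ▷ W ≫ (α_ X (X ⊗ X) W ≪≫ whiskerLeftIso X
        (α_ X X W ≪≫ whiskerLeftIso X (Iso.refl (X ⊗ W)) ≪≫ Iso.refl (X ⊗ (X ⊗ W))) ≪≫
        Iso.refl (X ⊗ (X ⊗ (X ⊗ W)))).hom = cupApp p W ≫ splitApp p τ (X ⊗ W) :=
      fun W => by rw [cupApp_splitApp, hτ]; simp [vertexApp]
    exact key (e (strands X Z n))
      (.comp _ _ _ _ _ (.up _ _ _ (.cup n)) (.up _ _ _ (.split (n + 1))))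
  | id A => exact key (by simp [TensorWord.app]) (.id _)
  | associator_hom A B D =>
    refine key (g := 𝟙 _) ?_ (.id _)
    have e : ∀ (A B D W W₁ W₂ W₃ : C) (i : D ⊗ W ≅ W₁) (j : B ⊗ W₁ ≅ W₂) (k : A ⊗ W₂ ≅ W₃),
        (α_ (A ⊗ B) D W ≪≫ whiskerLeftIso (A ⊗ B) i ≪≫ α_ A B W₁ ≪≫ whiskerLeftIso A j ≪≫ k).hom =
        (α_ A B D).hom ▷ W ≫ (α_ A (B ⊗ D) W ≪≫ whiskerLeftIso A (α_ B D W ≪≫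
          whiskerLeftIso B i ≪≫ j) ≪≫ k).hom := fun A B D W W₁ W₂ W₃ i j k => by simp
    exact (Iso.inv_comp_eq _).2 ((e _ _ _ _ _ _ _ _ _ _).symm.trans (Category.comp_id _).symm)
  | associator_inv A B D =>
    refine key (g := 𝟙 _) ?_ (.id _)
    have e : ∀ (A B D W W₁ W₂ W₃ : C) (i : D ⊗ W ≅ W₁) (j : B ⊗ W₁ ≅ W₂) (k : A ⊗ W₂ ≅ W₃),
        (α_ A B D).inv ▷ W ≫
        (α_ (A ⊗ B) D W ≪≫ whiskerLeftIso (A ⊗ B) i ≪≫ α_ A B W₁ ≪≫ whiskerLeftIso A j ≪≫ k).hom =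
        (α_ A (B ⊗ D) W ≪≫ whiskerLeftIso A (α_ B D W ≪≫
          whiskerLeftIso B i ≪≫ j) ≪≫ k).hom := fun A B D W W₁ W₂ W₃ i j k => by simp
    exact (Iso.inv_comp_eq _).2 ((e _ _ _ _ _ _ _ _ _ _).trans (Category.comp_id _).symm)
  | leftUnitor_hom A =>
    refine key (g := 𝟙 _) ?_ (.id _)
    have e : ∀ (A W W₁ : C) (i : A ⊗ W ≅ W₁), (λ_ A).hom ▷ W ≫ i.hom =
        (α_ (𝟙_ C) A W ≪≫ whiskerLeftIso (𝟙_ C) i ≪≫ λ_ W₁).hom := fun A W W₁ i => by simp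
    exact (Iso.inv_comp_eq _).2 ((e _ _ _ _).trans (Category.comp_id _).symm)
  | leftUnitor_inv A =>
    refine key (g := 𝟙 _) ?_ (.id _)
    have e : ∀ (A W W₁ : C) (i : A ⊗ W ≅ W₁), (λ_ A).inv ▷ W ≫
        (α_ (𝟙_ C) A W ≪≫ whiskerLeftIso (𝟙_ C) i ≪≫ λ_ W₁).hom = i.hom := fun A W W₁ i => by simp
    exact (Iso.inv_comp_eq _).2 ((e _ _ _ _).trans (Category.comp_id _).symm)
  | rightUnitor_hom A =>
    refine key (g := 𝟙 _) ?_ (.id _)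
    have e : ∀ (A W W₁ : C) (i : A ⊗ W ≅ W₁), (ρ_ A).hom ▷ W ≫ i.hom =
        (α_ A (𝟙_ C) W ≪≫ whiskerLeftIso A (λ_ W) ≪≫ i).hom := fun A W W₁ i => by simp
    exact (Iso.inv_comp_eq _).2 ((e _ _ _ _).trans (Category.comp_id _).symm)
  | rightUnitor_inv A =>
    refine key (g := 𝟙 _) ?_ (.id _)
    have e : ∀ (A W W₁ : C) (i : A ⊗ W ≅ W₁), (ρ_ A).inv ▷ W ≫
        (α_ A (𝟙_ C) W ≪≫ whiskerLeftIso A (λ_ W) ≪≫ i).hom = i.hom := fun A W W₁ i => by simp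
    exact (Iso.inv_comp_eq _).2 ((e _ _ _ _).trans (Category.comp_id _).symm)
  | comp A B D f g _ _ ihf ihg =>
    refine key ?_ (.comp _ _ _ _ _ (ihf n) (ihg n))
    simp [TensorWord.app]
  | tensor A B D E f g _ _ ihf ihg =>
    refine key ?_ (.comp _ _ _ _ _ (IsLayered.whisker_word A (ihg n)) (ihf (E.shift n)))
    have e : ∀ {A B D E W W₁ W₂ W₃ W₄ : C} (f : A ⟶ B) (g : D ⟶ E) (i : D ⊗ W ≅ W₁)
        (j : E ⊗ W ≅ W₂) (k : A ⊗ W₁ ≅ W₃) (k' : A ⊗ W₂ ≅ W₄) {W₅ : C} (l : B ⊗ W₂ ≅ W₅),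
        (α_ A D W ≪≫ whiskerLeftIso A i ≪≫ k).inv ≫ (f ⊗ₘ g) ▷ W ≫
          (α_ B E W ≪≫ whiskerLeftIso B j ≪≫ l).hom =
        (k.inv ≫ A ◁ (i.inv ≫ g ▷ W ≫ j.hom) ≫ k'.hom) ≫ k'.inv ≫ f ▷ W₂ ≫ l.hom := by
      intro A B D E W W₁ W₂ W₃ W₄ f g i j k k' W₅ l
      have hx : A ◁ j.hom ≫ f ▷ W₂ = f ▷ (E ⊗ W) ≫ B ◁ j.hom := whisker_exchange _ _
      simp [MonoidalCategory.tensorHom_def', reassoc_of% hx]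
    exact e _ _ _ _ _ _ _
  | add A B f g _ _ ihf ihg =>
    refine key ?_ (.add _ _ _ _ (ihf n) (ihg n))
    simp [TensorWord.app]
  | smul A B c f _ ih =>
    refine key ?_ (.smul _ _ c _ (ih n))
    simp [TensorWord.app]

end Words

/-! ### Forests with at most four leaves, and the span of endomorphisms of two strands. -/

section Forests

variable {C : Type u} [Category.{v} C] [MonoidalCategory C] {X : C}

/-- Two nested cups to the left of `Z`. -/
def nestApp (p : ExactPairing X X) (Z : C) : Z ⟶ X ⊗ (X ⊗ (X ⊗ (X ⊗ Z))) :=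
  cupApp p Z ≫ X ◁ cupApp p (X ⊗ Z)

theorem nestApp_capApp (p : ExactPairing X X) (Z : C) :
    nestApp p Z ≫ capApp p (X ⊗ (X ⊗ Z)) = cupApp p Z := by
  rw [nestApp, Category.assoc, cupApp_capApp_right, Category.comp_id]

theorem nestApp_mergeApp (p : ExactPairing X X) (τ : 𝟙_ C ⟶ X ⊗ (X ⊗ X)) (Z : C) :
    nestApp p Z ≫ mergeApp p τ (X ⊗ (X ⊗ Z)) = cupApp p Z ≫ splitApp p τ (X ⊗ Z) := by
  rw [nestApp, Category.assoc, ← splitApp_eq_bend_right]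

theorem nestApp_ladderApp (p : ExactPairing X X) (τ : 𝟙_ C ⟶ X ⊗ (X ⊗ X)) (Z : C) :
    nestApp p Z ≫ ladderApp p τ (X ⊗ (X ⊗ Z)) =
      cupApp p Z ≫ splitApp p τ (X ⊗ Z) ≫ X ◁ splitApp p τ (X ⊗ Z) := by
  rw [nestApp, ladderApp, Category.assoc, ← reassoc_of% (splitApp_naturality p τ (cupApp p (X ⊗ Z))),
    ← whiskerLeft_comp, ← splitApp_eq_bend_right]

/-- Two nested caps to the right of two strands cancel two nested cups. -/
theorem nestApp_cancel (p : ExactPairing X X) (Z : C) :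
    nestApp p (X ⊗ (X ⊗ Z)) ≫ X ◁ X ◁ (X ◁ capApp p (X ⊗ Z) ≫ capApp p Z) = 𝟙 _ := by
  rw [nestApp, whiskerLeft_comp, whiskerLeft_comp, Category.assoc,
    ← whiskerLeft_comp_assoc X (cupApp p _),
    cupApp_naturality, whiskerLeft_comp, Category.assoc,
    reassoc_of% (cupApp_capApp_left p (X ⊗ Z)), ← whiskerLeft_comp, cupApp_capApp_left,
    whiskerLeft_id]

variable {p : ExactPairing X X} {τ : 𝟙_ C ⟶ X ⊗ (X ⊗ X)} {Z : C}

theorem IsUpStep.lt {n m : ℕ} {g : strands X Z n ⟶ strands X Z m}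
    (hg : IsUpStep p τ Z n m g) : n < m := by
  induction hg <;> omega

variable [Preadditive C] [Linear ℂ C]

/-- The forests with at most four upper boundary points. -/
def ForestShape (p : ExactPairing X X) (τ : 𝟙_ C ⟶ X ⊗ (X ⊗ X)) (Z : C) :
    ∀ n : ℕ, (Z ⟶ strands X Z n) → Prop
  | 0, w => ∃ c : ℂ, w = c • 𝟙 Z
  | 1, w => w = 0
  | 2, w => ∃ c : ℂ, w = c • cupApp p Z
  | 3, w => ∃ c : ℂ, w = c • (cupApp p Z ≫ splitApp p τ (X ⊗ Z))
  | 4, w => ∃ a b c : ℂ, w = a • nestApp p Z +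
      b • (nestApp p Z ≫ capApp p (X ⊗ (X ⊗ Z)) ≫ cupApp p (X ⊗ (X ⊗ Z))) +
      c • (nestApp p Z ≫ mergeApp p τ (X ⊗ (X ⊗ Z)) ≫ splitApp p τ (X ⊗ (X ⊗ Z)))
  | _ + 5, _ => True

theorem ForestShape.add {n : ℕ} {w w' : Z ⟶ strands X Z n} (hw : ForestShape p τ Z n w)
    (hw' : ForestShape p τ Z n w') : ForestShape p τ Z n (w + w') := by
  match n, w, w', hw, hw' with
  | 0, _, _, ⟨c, rfl⟩, ⟨c', rfl⟩ => exact ⟨c + c', (add_smul _ _ _).symm⟩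
  | 1, _, _, hw, hw' => exact (congrArg₂ (· + ·) hw hw').trans (add_zero 0)
  | 2, _, _, ⟨c, rfl⟩, ⟨c', rfl⟩ => exact ⟨c + c', (add_smul _ _ _).symm⟩
  | 3, _, _, ⟨c, rfl⟩, ⟨c', rfl⟩ => exact ⟨c + c', (add_smul _ _ _).symm⟩
  | 4, _, _, ⟨a, b, c, rfl⟩, ⟨a', b', c', rfl⟩ =>
    exact ⟨a + a', b + b', c + c', by simp only [add_smul]; abel⟩
  | _ + 5, _, _, _, _ => trivial

theorem ForestShape.smul {n : ℕ} {w : Z ⟶ strands X Z n} (hw : ForestShape p τ Z n w) (k : ℂ) :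
    ForestShape p τ Z n (k • w) := by
  match n, w, hw with
  | 0, _, ⟨c, rfl⟩ => exact ⟨k * c, smul_smul _ _ _⟩
  | 1, _, hw => exact (congrArg (k • ·) hw).trans (smul_zero k)
  | 2, _, ⟨c, rfl⟩ => exact ⟨k * c, smul_smul _ _ _⟩
  | 3, _, ⟨c, rfl⟩ => exact ⟨k * c, smul_smul _ _ _⟩
  | 4, _, ⟨a, b, c, rfl⟩ =>
    exact ⟨k * a, k * b, k * c, by simp only [smul_add, smul_smul]⟩
  | _ + 5, _, _ => trivial

theorem ForestShape.zero (n : ℕ) : ForestShape p τ Z n 0 := by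
  match n with
  | 0 => exact ⟨0, (zero_smul _ _).symm⟩
  | 1 => rfl
  | 2 => exact ⟨0, (zero_smul _ _).symm⟩
  | 3 => exact ⟨0, (zero_smul _ _).symm⟩
  | 4 => exact ⟨0, 0, 0, by simp⟩
  | _ + 5 => trivial

variable {d a b c : ℂ}

theorem ForestShape.of_five_le {n : ℕ} (hn : 5 ≤ n) (w : Z ⟶ strands X Z n) :
    ForestShape p τ Z n w := by
  obtain ⟨k, rfl⟩ := Nat.exists_eq_add_of_le' hn
  trivial

/-- Up to rotation there are few forests with so few leaves. The ladder relation is needed in one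
place only: when the middle leg of a three-legged vertex splits, the result is a ladder on nested
cups. -/
theorem ForestShape.up (S : HasForestSkein p τ d a b c) {n m : ℕ} {w : Z ⟶ strands X Z n}
    (hw : ForestShape p τ Z n w) {g : strands X Z n ⟶ strands X Z m}
    (hg : IsUpStep p τ Z n m g) : ForestShape p τ Z m (w ≫ g) := by
  match n, w, hw with
  | 0, _, ⟨k, rfl⟩ =>
    cases hg with
    | cup => exact ⟨k, by simp⟩
  | 1, w, hw =>
    obtain rfl : w = 0 := hw
    rw [zero_comp]
    exact .zero m
  | 2, _, ⟨k, rfl⟩ =>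
    rw [Linear.smul_comp]
    apply ForestShape.smul
    cases hg with
    | cup =>
      refine ⟨0, 1, 0, ?_⟩
      rw [reassoc_of% (nestApp_capApp p Z)]; simp
    | split => exact ⟨1, (one_smul _ _).symm⟩
    | whisker _ m g hg =>
      cases hg with
      | cup => exact ⟨1, 0, 0, by simp [nestApp]⟩
      | split => exact ⟨1, by rw [one_smul, cupApp_splitApp_eq S.rotate]⟩
      | whisker _ m g hg =>
        cases hg with
        | cup =>
          refine ⟨0, 1, 0, ?_⟩
          rw [reassoc_of% (nestApp_capApp p Z), cupApp_naturality]; simp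
  | 3, _, ⟨k, rfl⟩ =>
    rw [Linear.smul_comp]
    apply ForestShape.smul
    cases hg with
    | cup => trivial
    | split =>
      refine ⟨0, 0, 1, ?_⟩
      rw [reassoc_of% (nestApp_mergeApp p τ Z)]; simp
    | whisker _ m g hg =>
      cases hg with
      | cup => trivial
      | split =>
        refine ⟨a, b, c, ?_⟩
        rw [Category.assoc, ← nestApp_ladderApp, S.ladder_eq]
        simp
      | whisker _ m g hg =>
        cases hg with
        | cup => trivial
        | split =>
          refine ⟨0, 0, 1, ?_⟩
          rw [reassoc_of% (nestApp_mergeApp p τ Z), Category.assoc, splitApp_naturality,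
            ← reassoc_of% (cupApp_splitApp_eq S.rotate Z)]
          simp
        | whisker _ m g hg =>
          cases hg with
          | cup => trivial
  -- Up steps strictly increase the number of strands, so nothing has to be tracked beyond four.
  | 4, _, _ => exact .of_five_le hg.lt _
  | n + 5, _, _ => exact .of_five_le (by have := hg.lt; omega) _

theorem IsForest.shape (S : HasForestSkein p τ d a b c) {n : ℕ} {w : Z ⟶ strands X Z n}
    (hw : IsForest p τ Z n w) : ForestShape p τ Z n w := by
  induction hw with
  | id => exact ⟨1, (one_smul _ _).symm⟩
  | up n m w g _ hg ih => exact ih.up S hg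
  | add n w w' _ _ ih ih' => exact ih.add ih'
  | smul n k w _ ih => exact ih.smul k
  | zero n => exact .zero n

variable [MonoidalPreadditive C] [MonoidalLinear ℂ C]

/-- If the ladder is a combination of the diagrams without a rung, then these diagrams span all
linear combinations of diagrams with two lower and two upper legs. -/
theorem HasForestSkein.exists_endApp_eq (S : HasForestSkein p τ d a b c) {f : X ⊗ X ⟶ X ⊗ X}
    (hf : IsDiagramSum p τ (.tensor .letter .letter) (.tensor .letter .letter) f) (Z : C) :
    ∃ k₁ k₂ k₃ : ℂ, endApp f Z = k₁ • 𝟙 _ + k₂ • (capApp p Z ≫ cupApp p Z) +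
      k₃ • (mergeApp p τ Z ≫ splitApp p τ Z) := by
  -- Nested cups bend the lower legs of `f` upwards, so that the classification of forests applies.
  -- The base object is X ⊗ (X ⊗ Z) instead of Z, so that nested caps can bend the two legs back at
  -- the end.
  have hn : IsForest p τ (X ⊗ (X ⊗ Z)) 4 (𝟙 _ ≫ cupApp p _ ≫ X ◁ cupApp p _) := by
    rw [← Category.assoc]
    exact .up _ _ _ _ (.up _ _ _ _ .id (.cup 0)) (.whisker _ _ _ (.cup 1))
  have e : ∀ W : C, (α_ X X W ≪≫ whiskerLeftIso X (Iso.refl (X ⊗ W)) ≪≫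
      Iso.refl (X ⊗ (X ⊗ W))).inv ≫ f ▷ W ≫ (α_ X X W ≪≫ whiskerLeftIso X (Iso.refl (X ⊗ W)) ≪≫
      Iso.refl (X ⊗ (X ⊗ W))).hom = endApp f W := fun W => by simp [endApp]
  have hl := IsLayered.of_isDiagramSum (Z := X ⊗ (X ⊗ Z)) S.rotate hf 2
  obtain ⟨k₁, k₂, k₃, h⟩ := (hn.comp S hl).shape S
  refine ⟨k₁, k₂, k₃, ?_⟩
  have h' : nestApp p (X ⊗ (X ⊗ Z)) ≫ endApp f (X ⊗ (X ⊗ (X ⊗ (X ⊗ Z)))) =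
      (𝟙 _ ≫ cupApp p _ ≫ X ◁ cupApp p _) ≫
        TensorWord.app (X := X) (A := .tensor .letter .letter) (B := .tensor .letter .letter)
          (X ⊗ (X ⊗ Z)) f 2 := by
    rw [← e, Category.id_comp]
    rfl
  have hc := congrArg (· ≫ X ◁ X ◁ (X ◁ capApp p (X ⊗ Z) ≫ capApp p Z)) (h'.trans h)
  have hcancel : ∀ g : ∀ W : C, X ⊗ (X ⊗ W) ⟶ X ⊗ (X ⊗ W),
      (∀ {W W' : C} (k : W ⟶ W'), X ◁ X ◁ k ≫ g W' = g W ≫ X ◁ X ◁ k) →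
      (nestApp p (X ⊗ (X ⊗ Z)) ≫ g (X ⊗ (X ⊗ (X ⊗ (X ⊗ Z))))) ≫
        X ◁ X ◁ (X ◁ capApp p (X ⊗ Z) ≫ capApp p Z) = g Z := fun g hg => by
    rw [Category.assoc, ← hg, reassoc_of% (nestApp_cancel p Z)]
  simp only [Preadditive.add_comp, Linear.smul_comp] at hc
  rw [hcancel (endApp f) (fun k => endApp_naturality f k), nestApp_cancel,
    hcancel (fun W => capApp p W ≫ cupApp p W) (fun k => by
      rw [reassoc_of% (capApp_naturality p k), Category.assoc, cupApp_naturality]),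
    hcancel (fun W => mergeApp p τ W ≫ splitApp p τ W) (fun k => by
      rw [reassoc_of% (mergeApp_naturality p τ k), Category.assoc, splitApp_naturality])] at hc
  exact hc

end Forests

/-! ### Schur's lemma and resolutions of the identity. -/

section Semisimple

set_option linter.unusedSectionVars false

attribute [local instance] Abelian.hasFiniteBiproducts

variable {C : Type u} [Category.{v} C] [Abelian C] [Linear ℂ C] [MonoidalCategory C]
  [MonoidalPreadditive C] [MonoidalLinear ℂ C] [RigidCategory C] [IsFusionCategory C]

namespace H3Structure

variable (H : H3Structure C)

theorem hom_eq_zero {a b : H3Label} (hab : a ≠ b) (f : H.obj a ⟶ H.obj b) : f = 0 := by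
  have := H.simple_obj a
  have := H.simple_obj b
  by_contra hf
  have := isIso_of_hom_simple hf
  exact hab (H.eq_of_iso a b ⟨asIso f⟩)

theorem hom_eq_zero_of_iso {X Y : C} {a b : H3Label} (hab : a ≠ b)
    (hX : Nonempty (X ≅ H.obj a)) (hY : Nonempty (Y ≅ H.obj b)) (f : X ⟶ Y) : f = 0 := by
  obtain ⟨i⟩ := hX
  obtain ⟨j⟩ := hY
  have h := H.hom_eq_zero hab (i.inv ≫ f ≫ j.hom)
  calc f = i.hom ≫ (i.inv ≫ f ≫ j.hom) ≫ j.inv := by simp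
    _ = 0 := by rw [h]; simp

theorem id_ne_zero (a : H3Label) : 𝟙 (H.obj a) ≠ 0 :=
  have := H.simple_obj a
  CategoryTheory.id_nonzero (H.obj a)

theorem exists_smul_id {X : C} [Simple X] (f : X ⟶ X) : ∃ k : ℂ, f = k • 𝟙 X := by
  have := IsFusionCategory.finiteDimensional_hom X X
  obtain ⟨k, hk⟩ := endomorphism_simple_eq_smul_id ℂ f
  exact ⟨k, hk.symm⟩

theorem hom_tensor_eq_zero {a b c : H3Label} (hc : c ∉ H3Label.fusion a b)
    (f : H.obj c ⟶ H.obj a ⊗ H.obj b) : f = 0 := by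
  have := IsFusionCategory.finiteDimensional_hom (H.obj c) (H.obj a ⊗ H.obj b)
  have h := H.finrank_hom a b c
  rw [if_neg hc, Module.finrank_zero_iff] at h
  exact Subsingleton.elim _ _

theorem exists_eq_smul {a b c : H3Label} (hc : c ∈ H3Label.fusion a b)
    {w : H.obj c ⟶ H.obj a ⊗ H.obj b} (hw : w ≠ 0) (f : H.obj c ⟶ H.obj a ⊗ H.obj b) :
    ∃ k : ℂ, f = k • w := by
  have h := H.finrank_hom a b c
  rw [if_pos hc] at h
  obtain ⟨k, hk⟩ := (finrank_eq_one_iff_of_nonzero' w hw).1 h f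
  exact ⟨k, hk.symm⟩

/-- In a tensor product of simple objects the identity is the sum of the projections onto the
summands. -/
theorem exists_dual (a b : H3Label) (w : ∀ c, H.obj c ⟶ H.obj a ⊗ H.obj b)
    (hw : ∀ c ∈ H3Label.fusion a b, w c ≠ 0) :
    ∃ q : ∀ c, H.obj a ⊗ H.obj b ⟶ H.obj c,
      ∑ c ∈ H3Label.fusion a b, q c ≫ w c = 𝟙 (H.obj a ⊗ H.obj b) ∧
      ∀ c ∈ H3Label.fusion a b, w c ≫ q c = 𝟙 (H.obj c) := by
  obtain ⟨n, S, hS, ⟨i⟩⟩ := IsFusionCategory.semisimple (H.obj a ⊗ H.obj b)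
  -- Multiplicity one makes the inclusion of each simple summand a multiple of some `w c`; a label
  -- outside the fusion rule would force the summand to be zero. Collecting the summands by label
  -- then gives the projections.
  have hS' : ∀ k, ∃ c, ∃ r : H.obj a ⊗ H.obj b ⟶ H.obj c, c ∈ H3Label.fusion a b ∧
      r ≫ w c = i.hom ≫ biproduct.π S k ≫ biproduct.ι S k ≫ i.inv := by
    intro k
    obtain ⟨c, ⟨j⟩⟩ := H.exists_iso_of_simple (S k) (hS k)
    by_cases hc : c ∈ H3Label.fusion a b
    · obtain ⟨l, hl⟩ := H.exists_eq_smul hc (hw c hc) (j.inv ≫ biproduct.ι S k ≫ i.inv)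
      refine ⟨c, l • (i.hom ≫ biproduct.π S k ≫ j.hom), hc, ?_⟩
      rw [Linear.smul_comp, ← Linear.comp_smul, ← hl]
      simp
    · exfalso
      have h := H.hom_tensor_eq_zero hc (j.inv ≫ biproduct.ι S k ≫ i.inv)
      have h' : 𝟙 (S k) = 0 := by
        calc 𝟙 (S k) = j.hom ≫ (j.inv ≫ biproduct.ι S k ≫ i.inv) ≫ i.hom ≫ biproduct.π S k := by
              simp
          _ = 0 := by rw [h]; simp
      have := hS k
      exact id_nonzero (S k) h'
  choose l r hl hr using hS'
  have hsum : ∑ c ∈ H3Label.fusion a b,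
      (∑ k, if h : l k = c then r k ≫ eqToHom (congrArg H.obj h) else 0) ≫ w c =
      𝟙 (H.obj a ⊗ H.obj b) := by
    calc _ = ∑ k, ∑ c ∈ H3Label.fusion a b,
          (if h : l k = c then r k ≫ eqToHom (congrArg H.obj h) else 0) ≫ w c := by
          rw [Finset.sum_comm]
          exact Finset.sum_congr rfl fun c _ => Preadditive.sum_comp _ _ _
      _ = ∑ k, r k ≫ w (l k) := by
          refine Finset.sum_congr rfl fun k _ => ?_
          rw [Finset.sum_eq_single_of_mem (l k) (hl k)]
          · simp
          · intro c _ hc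
            rw [dif_neg (Ne.symm hc), zero_comp]
      _ = i.hom ≫ (∑ k, biproduct.π S k ≫ biproduct.ι S k) ≫ i.inv := by
          simp only [hr, Preadditive.comp_sum, Preadditive.sum_comp, Category.assoc]
      _ = 𝟙 _ := by rw [biproduct.total]; simp
  refine ⟨_, hsum, fun c hc => ?_⟩
  set q := fun c => ∑ k, if h : l k = c then r k ≫ eqToHom (congrArg H.obj h) else 0 with hq
  have := H.simple_obj c
  -- The composite is a scalar by Schur, and composing `w c` with the resolution of the identity
  -- shows that the scalar is 1.
  obtain ⟨k, hk⟩ := exists_smul_id (w c ≫ q c)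
  have h : w c = k • w c := by
    calc w c = w c ≫ ∑ c ∈ H3Label.fusion a b, q c ≫ w c := by rw [hsum, Category.comp_id]
      _ = (w c ≫ q c) ≫ w c := by
          rw [Preadditive.comp_sum, Finset.sum_eq_single_of_mem c hc, Category.assoc]
          intro c' _ hc'
          rw [← Category.assoc, H.hom_eq_zero (Ne.symm hc') (w c ≫ q c'), zero_comp]
      _ = k • w c := by rw [hk]; simp
  have hk1 : k = 1 := by
    have : (1 - k) • w c = 0 := by rw [sub_smul, one_smul, ← h, sub_self]
    have := (smul_eq_zero.1 this).resolve_right (hw c hc)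
    linear_combination -this
  exact hk.trans (by rw [hk1, one_smul])

theorem exists_basis (a b : H3Label) : ∃ w : ∀ c, H.obj c ⟶ H.obj a ⊗ H.obj b,
    ∀ c ∈ H3Label.fusion a b, w c ≠ 0 := by
  have : ∀ c, ∃ w : H.obj c ⟶ H.obj a ⊗ H.obj b, c ∈ H3Label.fusion a b → w ≠ 0 := by
    intro c
    by_cases hc : c ∈ H3Label.fusion a b
    · have h := H.finrank_hom a b c
      rw [if_pos hc] at h
      have := Module.nontrivial_of_finrank_pos (R := ℂ) (h ▸ one_pos)
      obtain ⟨w, hw⟩ := exists_ne (0 : H.obj c ⟶ H.obj a ⊗ H.obj b)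
      exact ⟨w, fun _ => hw⟩
    · exact ⟨0, fun h => absurd h hc⟩
  choose w hw using this
  exact ⟨w, hw⟩

theorem tensor_iso {a b c : H3Label} (h : H3Label.fusion a b = {c}) :
    Nonempty (H.obj a ⊗ H.obj b ≅ H.obj c) := by
  obtain ⟨w, hw⟩ := H.exists_basis a b
  obtain ⟨q, h₁, h₂⟩ := H.exists_dual a b w hw
  rw [h, Finset.sum_singleton] at h₁
  exact ⟨q c, w c, h₁, h₂ c (by simp [h])⟩

end H3Structure

end Semisimple

/-! ### Invertible objects and moving them past strands. -/

section Invertible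

variable {C : Type u} [Category.{v} C] [MonoidalCategory C]

theorem isEquivalence_tensorRight {Y W : C} (i : Y ⊗ W ≅ 𝟙_ C) (j : W ⊗ Y ≅ 𝟙_ C) :
    (tensorRight Y).IsEquivalence :=
  (CategoryTheory.Equivalence.mk (tensorRight Y) (tensorRight W)
    ((rightUnitorNatIso C).symm ≪≫ (tensoringRight C).mapIso i.symm ≪≫ tensorRightTensor Y W)
    ((tensorRightTensor W Y).symm ≪≫ (tensoringRight C).mapIso j ≪≫
      rightUnitorNatIso C)).isEquivalence_functor

theorem isEquivalence_tensorLeft {Y W : C} (i : Y ⊗ W ≅ 𝟙_ C) (j : W ⊗ Y ≅ 𝟙_ C) :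
    (tensorLeft Y).IsEquivalence :=
  (CategoryTheory.Equivalence.mk (tensorLeft Y) (tensorLeft W)
    ((leftUnitorNatIso C).symm ≪≫ (tensoringLeft C).mapIso j.symm ≪≫ tensorLeftTensor W Y)
    ((tensorLeftTensor Y W).symm ≪≫ (tensoringLeft C).mapIso i ≪≫
      leftUnitorNatIso C)).isEquivalence_functor

variable {A B X : C}

/-- Moving an object past two strands, one after the other. -/
def crossTwo (s : A ⊗ X ≅ X ⊗ B) (s' : B ⊗ X ≅ X ⊗ A) : A ⊗ (X ⊗ X) ≅ (X ⊗ X) ⊗ A :=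
  (α_ A X X).symm ≪≫ whiskerRightIso s X ≪≫ α_ X B X ≪≫ whiskerLeftIso X s' ≪≫ (α_ X X A).symm

/-- Moving an object past three strands, one after the other. -/
def crossThree (s : A ⊗ X ≅ X ⊗ B) (s' : B ⊗ X ≅ X ⊗ A) :
    A ⊗ (X ⊗ (X ⊗ X)) ≅ (X ⊗ (X ⊗ X)) ⊗ B :=
  (α_ A X (X ⊗ X)).symm ≪≫ whiskerRightIso s (X ⊗ X) ≪≫ α_ X B (X ⊗ X) ≪≫
    whiskerLeftIso X (crossTwo s' s) ≪≫ (α_ X (X ⊗ X) B).symm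

/-- `crossThree` is defined as one strand followed by two. Regrouped as two followed by one, it
makes the first pair of strands as accessible as the last pair. -/
theorem crossThree_hom_eq (s : A ⊗ X ≅ X ⊗ B) (s' : B ⊗ X ≅ X ⊗ A) :
    (crossThree s s').hom = A ◁ (α_ X X X).inv ≫ (α_ A (X ⊗ X) X).inv ≫ (crossTwo s s').hom ▷ X ≫
      (α_ (X ⊗ X) A X).hom ≫ (X ⊗ X) ◁ s.hom ≫ (α_ (X ⊗ X) X B).inv ≫ (α_ X X X).hom ▷ B := by
  simp only [crossThree, crossTwo, Iso.trans_hom, Iso.symm_hom, whiskerRightIso_hom,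
    whiskerLeftIso_hom]
  monoidal

theorem crossThree_endApp (s : A ⊗ X ≅ X ⊗ B) (s' : B ⊗ X ≅ X ⊗ A) {f f' : X ⊗ X ⟶ X ⊗ X}
    (h : A ◁ f ≫ (crossTwo s s').hom = (crossTwo s s').hom ≫ f' ▷ A) :
    A ◁ endApp f X ≫ (crossThree s s').hom = (crossThree s s').hom ≫ endApp f' X ▷ B := by
  rw [crossThree_hom_eq]
  calc _ = A ◁ (α_ X X X).inv ≫ (α_ A (X ⊗ X) X).inv ≫ (A ◁ f ≫ (crossTwo s s').hom) ▷ X ≫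
      (α_ (X ⊗ X) A X).hom ≫ (X ⊗ X) ◁ s.hom ≫ (α_ (X ⊗ X) X B).inv ≫ (α_ X X X).hom ▷ B := by
        simp only [endApp]; monoidal
    _ = A ◁ (α_ X X X).inv ≫ (α_ A (X ⊗ X) X).inv ≫ (crossTwo s s').hom ▷ X ≫
      (α_ (X ⊗ X) A X).hom ≫ (f' ▷ (A ⊗ X) ≫ (X ⊗ X) ◁ s.hom) ≫ (α_ (X ⊗ X) X B).inv ≫
        (α_ X X X).hom ▷ B := by
        rw [h]; monoidal
    _ = _ := by
        rw [← whisker_exchange]; simp only [endApp]; monoidal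

theorem crossThree_whiskerLeft (s : A ⊗ X ≅ X ⊗ B) (s' : B ⊗ X ≅ X ⊗ A) {f f' : X ⊗ X ⟶ X ⊗ X}
    (h : B ◁ f ≫ (crossTwo s' s).hom = (crossTwo s' s).hom ≫ f' ▷ B) :
    A ◁ X ◁ f ≫ (crossThree s s').hom = (crossThree s s').hom ≫ (X ◁ f') ▷ B := by
  simp only [crossThree, Iso.trans_hom, Iso.symm_hom, whiskerRightIso_hom, whiskerLeftIso_hom]
  calc _ = (α_ A X (X ⊗ X)).inv ≫ ((A ⊗ X) ◁ f ≫ s.hom ▷ (X ⊗ X)) ≫ (α_ X B (X ⊗ X)).hom ≫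
        X ◁ (crossTwo s' s).hom ≫ (α_ X (X ⊗ X) B).inv := by monoidal
    _ = (α_ A X (X ⊗ X)).inv ≫ s.hom ▷ (X ⊗ X) ≫ (α_ X B (X ⊗ X)).hom ≫
        X ◁ (B ◁ f ≫ (crossTwo s' s).hom) ≫ (α_ X (X ⊗ X) B).inv := by
        rw [whisker_exchange]; monoidal
    _ = _ := by rw [h]; monoidal

theorem endApp_injective {f g : X ⊗ X ⟶ X ⊗ X} (h : endApp f (𝟙_ C) = endApp g (𝟙_ C)) : f = g := by
  have e : ∀ f : X ⊗ X ⟶ X ⊗ X, f = X ◁ (ρ_ X).inv ≫ endApp f (𝟙_ C) ≫ X ◁ (ρ_ X).hom := fun f => by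
    simp only [endApp]; monoidal
  rw [e f, e g, h]

theorem ladder_eq {p : ExactPairing X X} {τ : 𝟙_ C ⟶ X ⊗ (X ⊗ X)} (h : rotateVertex p τ = τ) :
    ladder p τ = X ◁ splitVertex p τ ≫ mergeApp p τ X :=
  calc ladder p τ = X ◁ (ρ_ X).inv ≫ endApp (ladder p τ) (𝟙_ C) ≫ X ◁ (ρ_ X).hom := by
        simp only [endApp]; monoidal
    _ = _ := by
        rw [endApp_ladder, ladderApp_eq h]; simp only [splitApp, mergeApp]; monoidal

end Invertible

/-! ### The four idempotents of ρ ⊗ ρ and their behaviour under crossing with powers of α. -/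

section Frame

set_option linter.unusedSectionVars false

variable {C : Type u} [Category.{v} C] [Abelian C] [Linear ℂ C] [MonoidalCategory C]
  [MonoidalPreadditive C] [MonoidalLinear ℂ C] [RigidCategory C] [IsFusionCategory C]

namespace H3Structure

open H3Label

variable (H : H3Structure C)

/-- The inclusions and projections of the four simple summands of `ρ ⊗ ρ`. -/
structure RhoFrame where
  /-- the inclusions -/
  w : ∀ c, H.obj c ⟶ H.obj rho ⊗ H.obj rho
  /-- the projections -/
  q : ∀ c, H.obj rho ⊗ H.obj rho ⟶ H.obj c
  sum_q_w : ∑ c ∈ fusion rho rho, q c ≫ w c = 𝟙 _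
  w_q : ∀ c ∈ fusion rho rho, w c ≫ q c = 𝟙 _
  w_rho : w rho = splitVertex H.selfDual H.vertex
  q_rho : q rho = mergeVertex H.selfDual H.vertex
  q_w_one : q one ≫ w one = (dRho : ℂ)⁻¹ • (cap H.selfDual ≫ cup H.selfDual)

theorem sum_fusion_rho_rho {M : Type*} [AddCommMonoid M] (f : H3Label → M) :
    ∑ c ∈ fusion rho rho, f c = f one + (f (powRho 0) + (f (powRho 1) + f (powRho 2))) := by
  have : fusion rho rho = {pow 0, powRho 0, powRho 1, powRho 2} := by decide
  rw [this, Finset.sum_insert (by decide), Finset.sum_insert (by decide),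
    Finset.sum_insert (by decide), Finset.sum_singleton]

theorem dRho_ne_zero : (dRho : ℂ) ≠ 0 := by
  have : dRho > 0 := by unfold dRho; positivity
  exact_mod_cast this.ne'

/-- The label `b` with `α^g ⊗ a ≅ b ⊗ α^g`, for `a` a summand of `ρ ⊗ ρ`. -/
def twist (g : ZMod 3) : H3Label → H3Label
  | pow h => pow h
  | powRho h => powRho (h + 2 * g)

variable {H}

/-- The idempotent of a summand of `ρ ⊗ ρ`. -/
def RhoFrame.e (F : H.RhoFrame) (c : H3Label) : H.obj rho ⊗ H.obj rho ⟶ H.obj rho ⊗ H.obj rho :=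
  F.q c ≫ F.w c

theorem RhoFrame.e_comp_e (F : H.RhoFrame) {c c' : H3Label} (hc : c ∈ fusion rho rho) :
    F.e c ≫ F.e c' = if c = c' then F.e c else 0 := by
  have : F.e c ≫ F.e c' = F.q c ≫ (F.w c ≫ F.q c') ≫ F.w c' := by simp [RhoFrame.e]
  rw [this]
  split_ifs with h
  · subst h
    rw [F.w_q c hc, Category.id_comp, RhoFrame.e]
  · rw [H.hom_eq_zero h (F.w c ≫ F.q c')]; simp

theorem mem_fusion_rho_rho {c : H3Label} :
    c ∈ fusion rho rho ↔ c = pow 0 ∨ ∃ k, c = powRho k := by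
  revert c; decide

/-- Both tensor products are simple. They have the same label only if `c'` is the twist of `c`,
because α^g passes to the right of α^k ρ at the cost of shifting k by 2g. -/
theorem cross_vanish (g : ZMod 3) {c c' : H3Label} (hc : c ∈ fusion rho rho)
    (hc' : c' ∈ fusion rho rho) (h : c' ≠ twist g c)
    (f : H.obj (pow g) ⊗ H.obj c ⟶ H.obj c' ⊗ H.obj (pow g)) : f = 0 := by
  have : ∃ a b, fusion (pow g) c = {a} ∧ fusion c' (pow g) = {b} ∧ a ≠ b := by
    obtain rfl | ⟨k, rfl⟩ := mem_fusion_rho_rho.1 hc <;>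
      obtain rfl | ⟨j, rfl⟩ := mem_fusion_rho_rho.1 hc'
    · exact absurd rfl h
    · exact ⟨_, _, rfl, rfl, by simp⟩
    · exact ⟨_, _, rfl, rfl, by simp⟩
    · refine ⟨_, _, rfl, rfl, fun e => h ?_⟩
      have e' : g + k = j - g := by simpa using e
      simp only [twist, powRho.injEq]
      linear_combination -e'
  obtain ⟨a, b, ha, hb, hab⟩ := this
  exact H.hom_eq_zero_of_iso hab (H.tensor_iso ha) (H.tensor_iso hb) f

/-- Written in blocks, `f` has only the entries from `a` to `twist g a`, since all others vanish by
Schur. Both sides are therefore equal to the same block, and nothing else about `f` matters. -/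
theorem RhoFrame.cross (F : H.RhoFrame) (g : ZMod 3)
    (f : H.obj (pow g) ⊗ (H.obj rho ⊗ H.obj rho) ⟶ (H.obj rho ⊗ H.obj rho) ⊗ H.obj (pow g))
    {c : H3Label} (hc : c ∈ fusion rho rho) :
    H.obj (pow g) ◁ F.e c ≫ f = f ≫ F.e (twist g c) ▷ H.obj (pow g) := by
  have hv : ∀ a ∈ fusion rho rho, ∀ b ∈ fusion rho rho, b ≠ twist g a →
      H.obj (pow g) ◁ F.e a ≫ f ≫ F.e b ▷ H.obj (pow g) = 0 := by
    intro a ha b hb hab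
    have h := cross_vanish g ha hb hab
      (H.obj (pow g) ◁ F.w a ≫ f ≫ F.q b ▷ H.obj (pow g))
    calc _ = H.obj (pow g) ◁ F.q a ≫ (H.obj (pow g) ◁ F.w a ≫ f ≫ F.q b ▷ H.obj (pow g)) ≫
          F.w b ▷ H.obj (pow g) := by simp [RhoFrame.e]
      _ = 0 := by rw [h]; simp
  have ht : twist g c ∈ fusion rho rho := by
    obtain rfl | ⟨k, rfl⟩ := mem_fusion_rho_rho.1 hc <;> simp [mem_fusion_rho_rho, twist]
  have hinj : ∀ a, twist g c = twist g a → a = c := by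
    intro a h
    cases c <;> cases a <;> simp_all [twist]
  have h₁ : H.obj (pow g) ◁ F.e c ≫ f =
      H.obj (pow g) ◁ F.e c ≫ f ≫ F.e (twist g c) ▷ H.obj (pow g) := by
    calc _ = H.obj (pow g) ◁ F.e c ≫ f ≫ (∑ b ∈ fusion rho rho, F.e b) ▷ H.obj (pow g) := by
          rw [show ∑ b ∈ fusion rho rho, F.e b = 𝟙 _ from F.sum_q_w]; simp
      _ = _ := by
          rw [sum_whiskerRight, Preadditive.comp_sum, Preadditive.comp_sum,
            Finset.sum_eq_single_of_mem _ ht]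
          exact fun b hb hne => hv c hc b hb hne
  have h₂ : f ≫ F.e (twist g c) ▷ H.obj (pow g) =
      H.obj (pow g) ◁ F.e c ≫ f ≫ F.e (twist g c) ▷ H.obj (pow g) := by
    calc _ = H.obj (pow g) ◁ (∑ b ∈ fusion rho rho, F.e b) ≫ f ≫
            F.e (twist g c) ▷ H.obj (pow g) := by
          rw [show ∑ b ∈ fusion rho rho, F.e b = 𝟙 _ from F.sum_q_w]; simp
      _ = _ := by
          rw [whiskerLeft_sum, Preadditive.sum_comp, Finset.sum_eq_single_of_mem _ hc]
          exact fun b hb hne => hv b hb _ ht (fun h => hne (hinj b h))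
  exact h₁.trans h₂.symm

end H3Structure

end Frame

/-! ### Partial traces of the basic diagrams. -/

section PartialTrace

variable {C : Type u} [Category.{v} C] [MonoidalCategory C] {X : C}

/-- The right partial trace of an endomorphism of `X ⊗ X`. -/
def partialTrace (p : ExactPairing X X) (f : X ⊗ X ⟶ X ⊗ X) : X ⟶ X :=
  (ρ_ X).inv ≫ X ◁ cup p ≫ endApp f X ≫ X ◁ cap p ≫ (ρ_ X).hom

variable (p : ExactPairing X X) (τ : 𝟙_ C ⟶ X ⊗ (X ⊗ X))

theorem partialTrace_eq (f : X ⊗ X ⟶ X ⊗ X) :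
    partialTrace p f = (ρ_ X).inv ≫ (X ◁ cupApp p (𝟙_ C) ≫ endApp f (X ⊗ 𝟙_ C) ≫
      X ◁ capApp p (𝟙_ C)) ≫ (ρ_ X).hom := by
  simp only [partialTrace, endApp, cupApp, capApp]; monoidal

theorem partialTrace_cap_cup : partialTrace p (cap p ≫ cup p) = 𝟙 X := by
  rw [partialTrace_eq, endApp_cap_cup]
  simp only [Category.assoc]
  rw [reassoc_of% (cupApp_capApp_right p (𝟙_ C)), reassoc_of% (cupApp_capApp_left p (𝟙_ C)),
    Iso.inv_hom_id]

theorem partialTrace_merge_split : partialTrace p (mergeVertex p τ ≫ splitVertex p τ) =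
    splitVertex p τ ≫ mergeVertex p τ := by
  rw [partialTrace_eq, endApp_merge_split]
  simp only [Category.assoc]
  rw [← reassoc_of% (mergeApp_eq p τ (𝟙_ C)),
    ← reassoc_of% (splitApp_eq_bend_right p τ (𝟙_ C))]
  simp [splitApp, mergeApp]

theorem partialTrace_ladder : partialTrace p (ladder p τ) =
    (ρ_ X).inv ≫ (splitApp p τ (𝟙_ C) ≫ X ◁ (splitApp p τ (𝟙_ C) ≫ capApp p (𝟙_ C))) ≫
      (ρ_ X).hom := by
  rw [partialTrace_eq, endApp_ladder, ladderApp]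
  simp only [Category.assoc]
  rw [← reassoc_of% (splitApp_naturality p τ (cupApp p (𝟙_ C))), splitApp_eq_bend_right p τ (𝟙_ C)]
  simp

end PartialTrace

/-! ### Existence of a frame adapted to cup and vertex, and conjugation by α. -/

section Frame

set_option linter.unusedSectionVars false

variable {C : Type u} [Category.{v} C] [Abelian C] [Linear ℂ C] [MonoidalCategory C]
  [MonoidalPreadditive C] [MonoidalLinear ℂ C] [RigidCategory C] [IsFusionCategory C]

namespace H3Structure

open H3Label

variable {H : H3Structure C}

theorem eq_smul_dual {a b : H3Label} {w : ∀ c, H.obj c ⟶ H.obj a ⊗ H.obj b}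
    {q : ∀ c, H.obj a ⊗ H.obj b ⟶ H.obj c}
    (hs : ∑ c ∈ fusion a b, q c ≫ w c = 𝟙 (H.obj a ⊗ H.obj b)) {c : H3Label}
    (hc : c ∈ fusion a b) (f : H.obj a ⊗ H.obj b ⟶ H.obj c) {k : ℂ} (hf : w c ≫ f = k • 𝟙 _) :
    f = k • q c := by
  calc f = (∑ c ∈ fusion a b, q c ≫ w c) ≫ f := by rw [hs, Category.id_comp]
    _ = q c ≫ w c ≫ f := by
        rw [Preadditive.sum_comp, Finset.sum_eq_single_of_mem c hc, Category.assoc]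
        intro c' _ hne
        rw [Category.assoc, H.hom_eq_zero hne (w c' ≫ f), comp_zero]
    _ = k • q c := by rw [hf]; simp

theorem unit_id_ne_zero : 𝟙 (𝟙_ C) ≠ 0 :=
  have := IsFusionCategory.simple_unit (C := C)
  id_nonzero (𝟙_ C)

theorem cup_ne_zero : cup H.selfDual ≠ 0 := by
  intro h
  have := H.loop_eq
  rw [loopDiagram, h, zero_comp] at this
  exact (smul_ne_zero dRho_ne_zero unit_id_ne_zero) this.symm

variable (H) in
theorem unit_to_rho_eq_zero (f : 𝟙_ C ⟶ H.obj rho) : f = 0 :=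
  H.hom_eq_zero_of_iso (by decide : one ≠ rho) (H.unit_iso.map Iso.symm) ⟨Iso.refl _⟩ f

variable (H) in
theorem rho_to_unit_eq_zero (f : H.obj rho ⟶ 𝟙_ C) : f = 0 :=
  H.hom_eq_zero_of_iso (by decide : rho ≠ one) ⟨Iso.refl _⟩ (H.unit_iso.map Iso.symm) f

/-- The cup and the splitting vertex serve as basis vectors for 1 and ρ. The dual projections are
then forced: the loop value makes the first one cap divided by d, and the bigon normalisation makes
the second one the merging vertex. -/
theorem exists_frame (hb : bigonDiagram H.selfDual H.vertex = 𝟙 _) : Nonempty H.RhoFrame := by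
  obtain ⟨u⟩ := H.unit_iso
  obtain ⟨w₀, hw₀⟩ := H.exists_basis rho rho
  have hs : splitVertex H.selfDual H.vertex ≠ 0 := by
    intro h
    rw [bigonDiagram, h, zero_comp] at hb
    exact H.id_ne_zero rho hb.symm
  have hu : u.hom ≫ cup H.selfDual ≠ 0 := by
    intro h
    apply cup_ne_zero (H := H)
    rw [← cancel_epi u.hom, h, comp_zero]
  let w := Function.update (Function.update w₀ one (u.hom ≫ cup H.selfDual)) rho
    (splitVertex H.selfDual H.vertex)
  have hw_rho : w rho = splitVertex H.selfDual H.vertex := Function.update_self _ _ _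
  have hw_one : w one = u.hom ≫ cup H.selfDual := by
    simp only [w]
    rw [Function.update_of_ne (by decide), Function.update_self]
  have hw : ∀ c ∈ fusion rho rho, w c ≠ 0 := by
    intro c hc
    by_cases h₁ : c = rho
    · subst h₁; rwa [hw_rho]
    by_cases h₂ : c = one
    · subst h₂; rwa [hw_one]
    simp only [w]
    rw [Function.update_of_ne h₁, Function.update_of_ne h₂]
    exact hw₀ c hc
  obtain ⟨q, hq₁, hq₂⟩ := H.exists_dual rho rho w hw
  refine ⟨⟨w, q, hq₁, hq₂, hw_rho, ?_, ?_⟩⟩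
  · have := eq_smul_dual hq₁ (by decide : rho ∈ fusion rho rho)
      (mergeVertex H.selfDual H.vertex) (k := 1) (by rw [hw_rho, one_smul]; exact hb)
    rw [this, one_smul]
  · have := eq_smul_dual hq₁ (by decide : one ∈ fusion rho rho) (cap H.selfDual ≫ u.inv)
      (k := dRho) (by
        have hl := H.loop_eq
        rw [loopDiagram] at hl
        rw [hw_one, Category.assoc, reassoc_of% hl, Linear.smul_comp, Linear.comp_smul,
          Category.id_comp, u.hom_inv_id])
    have h' : q one = (dRho : ℂ)⁻¹ • (cap H.selfDual ≫ u.inv) := by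
      rw [this, smul_smul, inv_mul_cancel₀ dRho_ne_zero, one_smul]
    rw [h', hw_one]; simp

variable (H)

theorem tensor_iso_tensor {a b c d e : H3Label} (h : fusion a b = {e}) (h' : fusion c d = {e}) :
    Nonempty (H.obj a ⊗ H.obj b ≅ H.obj c ⊗ H.obj d) :=
  (H.tensor_iso h).elim fun i => (H.tensor_iso h').elim fun j => ⟨i ≪≫ j.symm⟩

theorem isEquivalence_tensorRight_pow (g : ZMod 3) :
    (tensorRight (H.obj (pow g))).IsEquivalence := by
  obtain ⟨u⟩ := H.unit_iso
  obtain ⟨i⟩ := H.tensor_iso (a := pow g) (b := pow (-g)) (c := one) (by simp [fusion])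
  obtain ⟨j⟩ := H.tensor_iso (a := pow (-g)) (b := pow g) (c := one) (by simp [fusion])
  exact isEquivalence_tensorRight (i ≪≫ u) (j ≪≫ u)

theorem isEquivalence_tensorLeft_pow (g : ZMod 3) :
    (tensorLeft (H.obj (pow g))).IsEquivalence := by
  obtain ⟨u⟩ := H.unit_iso
  obtain ⟨i⟩ := H.tensor_iso (a := pow g) (b := pow (-g)) (c := one) (by simp [fusion])
  obtain ⟨j⟩ := H.tensor_iso (a := pow (-g)) (b := pow g) (c := one) (by simp [fusion])
  exact isEquivalence_tensorLeft (i ≪≫ u) (j ≪≫ u)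

variable {H}

/-- Moving `α` past three strands `ρ` permutes the idempotents of the first two strands and those
of the last two strands. -/
theorem RhoFrame.exists_cross (F : H.RhoFrame) :
    ∃ i : H.obj (pow 1) ⊗ (H.obj rho ⊗ (H.obj rho ⊗ H.obj rho)) ≅
      (H.obj rho ⊗ (H.obj rho ⊗ H.obj rho)) ⊗ H.obj (pow 2),
      (∀ c ∈ fusion rho rho, H.obj (pow 1) ◁ endApp (F.e c) (H.obj rho) ≫ i.hom =
        i.hom ≫ endApp (F.e (twist 1 c)) (H.obj rho) ▷ H.obj (pow 2)) ∧
      ∀ c ∈ fusion rho rho, H.obj (pow 1) ◁ H.obj rho ◁ F.e c ≫ i.hom =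
        i.hom ≫ (H.obj rho ◁ F.e (twist 2 c)) ▷ H.obj (pow 2) := by
  obtain ⟨s⟩ := H.tensor_iso_tensor (a := pow 1) (b := rho) (c := rho) (d := pow 2)
    (e := powRho 1) (by decide) (by decide)
  obtain ⟨s'⟩ := H.tensor_iso_tensor (a := pow 2) (b := rho) (c := rho) (d := pow 1)
    (e := powRho 2) (by decide) (by decide)
  exact ⟨crossThree s s', fun c hc => crossThree_endApp s s' (F.cross 1 _ hc),
    fun c hc => crossThree_whiskerLeft s s' (F.cross 2 _ hc)⟩

/-- Conjugation by `α` on the multiplicity space of `αρ` in `ρ ⊗ ρ ⊗ ρ`. -/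
theorem RhoFrame.exists_conj (F : H.RhoFrame) :
    ∃ T : (H.obj (powRho 1) ⟶ H.obj rho ⊗ (H.obj rho ⊗ H.obj rho)) →ₗ[ℂ]
      (H.obj (powRho 1) ⟶ H.obj rho ⊗ (H.obj rho ⊗ H.obj rho)),
      Function.Injective T ∧
      (∀ c ∈ fusion rho rho, ∀ v, T (v ≫ endApp (F.e c) (H.obj rho)) =
        T v ≫ endApp (F.e (twist 1 c)) (H.obj rho)) ∧
      ∀ c ∈ fusion rho rho, ∀ v, T (v ≫ H.obj rho ◁ F.e c) =
        T v ≫ H.obj rho ◁ F.e (twist 2 c) := by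
  obtain ⟨i, hp, hq⟩ := F.exists_cross
  obtain ⟨j⟩ := H.tensor_iso_tensor (a := pow 1) (b := powRho 1) (c := powRho 1) (d := pow 2)
    (e := powRho 2) (by decide) (by decide)
  have hr := H.isEquivalence_tensorRight_pow 2
  have hl := H.isEquivalence_tensorLeft_pow 1
  -- Tensoring with an invertible object is full and faithful. Hence α ⊗ v, after α is moved to the
  -- right on both ends, where it becomes α², has the form `T v` ⊗ α² for a unique `T v`.
  let T := fun v : H.obj (powRho 1) ⟶ H.obj rho ⊗ (H.obj rho ⊗ H.obj rho) =>
    (tensorRight (H.obj (pow 2))).preimage (j.inv ≫ H.obj (pow 1) ◁ v ≫ i.hom)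
  have hT : ∀ v, T v ▷ H.obj (pow 2) = j.inv ≫ H.obj (pow 1) ◁ v ≫ i.hom :=
    fun v => (tensorRight (H.obj (pow 2))).map_preimage _
  have hinj : ∀ {Y Z : C} {f g : Y ⟶ Z}, f ▷ H.obj (pow 2) = g ▷ H.obj (pow 2) → f = g :=
    fun h => (tensorRight (H.obj (pow 2))).map_injective h
  refine ⟨⟨⟨T, fun v w => hinj ?_⟩, fun k v => hinj ?_⟩, fun v w h => ?_, fun c hc v => hinj ?_,
    fun c hc v => hinj ?_⟩
  · rw [MonoidalPreadditive.add_whiskerRight, hT, hT, hT]; simp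
  · simp [hT]
  · have h' := congrArg (· ▷ H.obj (pow 2)) (show T v = T w from h)
    simp only [hT, cancel_epi, cancel_mono] at h'
    exact (tensorLeft (H.obj (pow 1))).map_injective h'
  · change T _ ▷ _ = (T v ≫ _) ▷ _
    rw [comp_whiskerRight, hT, hT, whiskerLeft_comp, Category.assoc, hp c hc]; simp
  · change T _ ▷ _ = (T v ≫ _) ▷ _
    rw [comp_whiskerRight, hT, hT, whiskerLeft_comp, Category.assoc, hq c hc]; simp

end H3Structure

end Frame

/-! ### Linearity of the diagrammatic operations. -/

section Linear

set_option linter.unusedSectionVars false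

variable {C : Type u} [Category.{v} C] [MonoidalCategory C] [Preadditive C] [Linear ℂ C]
  [MonoidalPreadditive C] [MonoidalLinear ℂ C] {X : C} (p : ExactPairing X X)

theorem endApp_add (f g : X ⊗ X ⟶ X ⊗ X) (Z : C) :
    endApp (f + g) Z = endApp f Z + endApp g Z := by simp [endApp]

theorem endApp_smul (k : ℂ) (f : X ⊗ X ⟶ X ⊗ X) (Z : C) :
    endApp (k • f) Z = k • endApp f Z := by simp [endApp]

theorem rotateApp_add (f g : X ⊗ X ⟶ X ⊗ X) (Z : C) :
    rotateApp p (f + g) Z = rotateApp p f Z + rotateApp p g Z := by simp [rotateApp, endApp_add]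

theorem rotateApp_smul (k : ℂ) (f : X ⊗ X ⟶ X ⊗ X) (Z : C) :
    rotateApp p (k • f) Z = k • rotateApp p f Z := by simp [rotateApp, endApp_smul]

theorem partialTrace_add (f g : X ⊗ X ⟶ X ⊗ X) :
    partialTrace p (f + g) = partialTrace p f + partialTrace p g := by
  simp [partialTrace, endApp_add]

theorem partialTrace_smul (k : ℂ) (f : X ⊗ X ⟶ X ⊗ X) :
    partialTrace p (k • f) = k • partialTrace p f := by simp [partialTrace, endApp_smul]

end Linear

/-! ### Relations between the eigenvalues of the ladder. -/

section Eigenvalues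

set_option linter.unusedSectionVars false

variable {C : Type u} [Category.{v} C] [Abelian C] [Linear ℂ C] [MonoidalCategory C]
  [MonoidalPreadditive C] [MonoidalLinear ℂ C] [RigidCategory C] [IsFusionCategory C]

namespace H3Structure

open H3Label

variable {H : H3Structure C}

theorem RhoFrame.split_merge (F : H.RhoFrame) :
    splitVertex H.selfDual H.vertex ≫ mergeVertex H.selfDual H.vertex = 𝟙 _ := by
  rw [← F.w_rho, ← F.q_rho, F.w_q rho (by decide)]

theorem RhoFrame.e_rho (F : H.RhoFrame) :
    F.e rho = mergeVertex H.selfDual H.vertex ≫ splitVertex H.selfDual H.vertex := by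
  rw [RhoFrame.e, F.w_rho, F.q_rho]

theorem RhoFrame.sum_e (F : H.RhoFrame) :
    F.e one + (F.e (powRho 0) + (F.e (powRho 1) + F.e (powRho 2))) = 𝟙 _ := by
  rw [← sum_fusion_rho_rho]; exact F.sum_q_w

theorem RhoFrame.w_comp_e (F : H.RhoFrame) {c c' : H3Label} (hc : c ∈ fusion rho rho) :
    F.w c ≫ F.e c' = if c = c' then F.w c else 0 := by
  rw [RhoFrame.e, ← Category.assoc]
  split_ifs with h
  · subst h; rw [F.w_q c hc, Category.id_comp]
  · rw [H.hom_eq_zero h (F.w c ≫ F.q c'), zero_comp]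

theorem RhoFrame.w_ne_zero (F : H.RhoFrame) {c : H3Label} (hc : c ∈ fusion rho rho) :
    F.w c ≠ 0 := by
  intro h
  have := F.w_q c hc
  rw [h, zero_comp] at this
  exact H.id_ne_zero c this.symm

theorem RhoFrame.e_one_smul (F : H.RhoFrame) :
    cap H.selfDual ≫ cup H.selfDual = (dRho : ℂ) • F.e one := by
  rw [RhoFrame.e, F.q_w_one, smul_smul, mul_inv_cancel₀ dRho_ne_zero, one_smul]

/-- Lollipops vanish because 1 and ρ are non-isomorphic simple objects; the other relations are the
loop value, the normalised bigon and the assumed ladder relation. -/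
theorem RhoFrame.exists_skein (F : H.RhoFrame) {a b c : ℂ}
    (h : ladder H.selfDual H.vertex = a • 𝟙 _ + b • (cap H.selfDual ≫ cup H.selfDual) +
      c • (mergeVertex H.selfDual H.vertex ≫ splitVertex H.selfDual H.vertex)) :
    HasForestSkein H.selfDual H.vertex dRho a b c where
  rotate := H.rotateVertex_vertex
  bigon W := by
    simp only [splitApp, mergeApp, Category.assoc, Iso.hom_inv_id_assoc]
    rw [← comp_whiskerRight, F.split_merge, id_whiskerRight]
  loop W := by
    have hl := H.loop_eq
    rw [loopDiagram] at hl
    simp only [cupApp, capApp, Category.assoc, Iso.hom_inv_id_assoc]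
    rw [← comp_whiskerRight_assoc, hl, MonoidalLinear.smul_whiskerRight, Linear.smul_comp,
      Linear.comp_smul]
    simp
  split_cap W := by
    simp only [splitApp, capApp, Category.assoc, Iso.hom_inv_id_assoc]
    rw [← comp_whiskerRight_assoc, H.rho_to_unit_eq_zero (_ ≫ _)]; simp
  cup_merge W := by
    simp only [cupApp, mergeApp, Category.assoc, Iso.hom_inv_id_assoc]
    rw [← comp_whiskerRight, H.unit_to_rho_eq_zero (_ ≫ _)]; simp
  ladder_eq W := by
    rw [← endApp_ladder, h, endApp_add, endApp_add, endApp_smul, endApp_smul, endApp_smul,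
      endApp_id, endApp_cap_cup, endApp_merge_split]

/-- The ladder acts by scalars on the summands of `ρ ⊗ ρ`. -/
theorem RhoFrame.exists_eigenvalue (F : H.RhoFrame) (k : ZMod 3) :
    ∃ x : ℂ, F.w (powRho k) ≫ ladder H.selfDual H.vertex = x • F.w (powRho k) :=
  have hk : powRho k ∈ fusion rho rho := mem_fusion_rho_rho.2 (Or.inr ⟨k, rfl⟩)
  H.exists_eq_smul hk (F.w_ne_zero hk) _

variable {t x y : ℂ}

variable (H t x y) in
/-- The scalars by which the ladder acts on `ρ`, `αρ` and `α*ρ`. -/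
structure RhoFrame.IsSpectrum (F : H.RhoFrame) : Prop where
  zero : F.w (powRho 0) ≫ ladder H.selfDual H.vertex = t • F.w (powRho 0)
  one : F.w (powRho 1) ≫ ladder H.selfDual H.vertex = x • F.w (powRho 1)
  two : F.w (powRho 2) ≫ ladder H.selfDual H.vertex = y • F.w (powRho 2)

namespace RhoFrame.IsSpectrum

variable {F : H.RhoFrame}

/-- On the unit summand the scalar is 1: when the ladder is attached to a cup, one vertex slides to
the other leg, and a bigon appears. -/
theorem ladder_eq (h : F.IsSpectrum H t x y) : ladder H.selfDual H.vertex =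
    F.e H3Label.one + (t • F.e (powRho 0) + (x • F.e (powRho 1) + y • F.e (powRho 2))) := by
  have h₁ : (cap H.selfDual ≫ cup H.selfDual) ≫ ladder H.selfDual H.vertex =
      cap H.selfDual ≫ cup H.selfDual := by
    apply endApp_injective
    rw [endApp_comp, endApp_cap_cup, endApp_ladder, ladderApp, Category.assoc,
      reassoc_of% (cupApp_splitApp_eq H.rotateVertex_vertex (𝟙_ C)), ← whiskerLeft_comp,
      splitApp, mergeApp, Category.assoc, Iso.hom_inv_id_assoc, ← comp_whiskerRight,
      F.split_merge]
    simp
  have h₂ : F.e H3Label.one ≫ ladder H.selfDual H.vertex = F.e H3Label.one := by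
    rw [RhoFrame.e, F.q_w_one, Linear.smul_comp, h₁]
  calc ladder H.selfDual H.vertex = 𝟙 _ ≫ ladder H.selfDual H.vertex := by simp
    _ = _ := by
      rw [← F.sum_e]
      simp only [Preadditive.add_comp, h₂]
      simp only [RhoFrame.e, Category.assoc, h.zero, h.one, h.two, Linear.comp_smul]

/-- The ladder separates `αρ` and `α*ρ`, since all endomorphisms of `ρ ⊗ ρ` are diagrams. -/
theorem ne (h : F.IsSpectrum H t x y) : x ≠ y := by
  intro hxy
  have hl : ladder H.selfDual H.vertex = x • 𝟙 _ +
      ((1 - x) / dRho) • (cap H.selfDual ≫ cup H.selfDual) +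
      (t - x) • (mergeVertex H.selfDual H.vertex ≫ splitVertex H.selfDual H.vertex) := by
    rw [h.ladder_eq, ← F.e_rho, F.e_one_smul, smul_smul, div_mul_cancel₀ _ dRho_ne_zero, ← hxy,
      ← F.sum_e]
    module
  -- The projection onto αρ would be a combination of three diagrams, which act by the same scalar
  -- k₁ on αρ and α*ρ. It has to act by 1 on the former and by 0 on the latter.
  obtain ⟨k₁, k₂, k₃, hk⟩ := (F.exists_skein hl).exists_endApp_eq
    (H.generated (.tensor .letter .letter) (.tensor .letter .letter) (F.e (powRho 1))) (𝟙_ C)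
  have hk' : F.e (powRho 1) = k₁ • 𝟙 _ + (k₂ * dRho) • F.e H3Label.one + k₃ • F.e rho := by
    apply endApp_injective
    rw [hk, endApp_add, endApp_add, endApp_smul, endApp_smul, endApp_smul, endApp_id, F.e_rho,
      endApp_merge_split, mul_smul, ← endApp_smul _ (F.e _), ← F.e_one_smul, endApp_cap_cup]
  have m₁ : powRho 1 ∈ fusion rho rho := by decide
  have m₂ : powRho 2 ∈ fusion rho rho := by decide
  have h₂ := congrArg (F.w (powRho 2) ≫ ·) hk'
  simp only [Preadditive.comp_add, Linear.comp_smul, F.w_comp_e m₂, Category.comp_id] at h₂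
  rw [if_neg (by decide), if_neg (by decide), if_neg (by decide)] at h₂
  simp only [smul_zero, add_zero] at h₂
  have hk₁ : k₁ = 0 := (smul_eq_zero.1 h₂.symm).resolve_right (F.w_ne_zero m₂)
  have h₁ := congrArg (F.w (powRho 1) ≫ ·) hk'
  simp only [Preadditive.comp_add, Linear.comp_smul, F.w_comp_e m₁, Category.comp_id] at h₁
  rw [if_pos trivial, if_neg (by decide), if_neg (by decide), hk₁] at h₁
  simp only [smul_zero, add_zero, zero_smul] at h₁
  exact F.w_ne_zero m₁ h₁

/-- The product (L − x)(L − y) kills αρ and α*ρ, so only its values (1 − x)(1 − y) on 1 and (t −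
x)(t − y) on ρ remain. -/
theorem square_eq (h : F.IsSpectrum H t x y) :
    ladder H.selfDual H.vertex ≫ ladder H.selfDual H.vertex =
      (x + y) • ladder H.selfDual H.vertex + (-(x * y)) • 𝟙 _ +
      ((1 - (x + y) + x * y) / dRho) • (cap H.selfDual ≫ cup H.selfDual) +
      (t ^ 2 - (x + y) * t + x * y) •
        (mergeVertex H.selfDual H.vertex ≫ splitVertex H.selfDual H.vertex) := by
  have m₀ : H3Label.one ∈ fusion rho rho := by decide
  have m₁ : powRho 0 ∈ fusion rho rho := by decide
  have m₂ : powRho 1 ∈ fusion rho rho := by decide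
  have m₃ : powRho 2 ∈ fusion rho rho := by decide
  rw [← F.e_rho, F.e_one_smul, smul_smul, div_mul_cancel₀ _ dRho_ne_zero, h.ladder_eq, ← F.sum_e]
  simp only [Preadditive.comp_add, Preadditive.add_comp, Linear.comp_smul, Linear.smul_comp,
    F.e_comp_e m₀, F.e_comp_e m₁, F.e_comp_e m₂, F.e_comp_e m₃]
  simp (decide := true) only [if_true, if_false, smul_zero, add_zero, zero_add]
  module

/-- Rotating the formula for L² exchanges the coefficients in pairs without changing the left side.
Evaluation on αρ and on α*ρ gives two equations, whose difference is divisible by x − y. -/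
theorem square_relations (h : F.IsSpectrum H t x y) :
    x + y = t ^ 2 - (x + y) * t + x * y ∧ -(x * y) * dRho = 1 - (x + y) + x * y := by
  have hR := rotateApp_ladder_ladder H.rotateVertex_vertex (𝟙_ C)
  have hsq : ladder H.selfDual H.vertex ≫ ladder H.selfDual H.vertex =
      (x + y) • (mergeVertex H.selfDual H.vertex ≫ splitVertex H.selfDual H.vertex) +
      (-(x * y)) • (cap H.selfDual ≫ cup H.selfDual) +
      ((1 - (x + y) + x * y) / dRho) • 𝟙 _ +
      (t ^ 2 - (x + y) * t + x * y) • ladder H.selfDual H.vertex := by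
    apply endApp_injective
    rw [← hR, h.square_eq]
    simp only [rotateApp_add, rotateApp_smul, endApp_add, endApp_smul, rotateApp_id,
      rotateApp_cap_cup, rotateApp_merge_split H.rotateVertex_vertex,
      rotateApp_ladder H.rotateVertex_vertex, endApp_id]
  rw [h.square_eq, ← F.e_rho, F.e_one_smul] at hsq
  have m₁ : powRho 1 ∈ fusion rho rho := by decide
  have m₂ : powRho 2 ∈ fusion rho rho := by decide
  have h₁ := congrArg (F.w (powRho 1) ≫ ·) hsq
  have h₂ := congrArg (F.w (powRho 2) ≫ ·) hsq
  simp only [Preadditive.comp_add, Linear.comp_smul, F.w_comp_e m₁, F.w_comp_e m₂,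
    Category.comp_id, h.one, h.two] at h₁ h₂
  rw [if_neg (by decide), if_neg (by decide)] at h₁ h₂
  simp only [smul_zero, add_zero, zero_add, smul_smul, ← add_smul] at h₁ h₂
  have h₁' := smul_left_injective ℂ (F.w_ne_zero m₁) h₁
  have h₂' := smul_left_injective ℂ (F.w_ne_zero m₂) h₂
  have hd := dRho_ne_zero
  have e₁ : x + y = t ^ 2 - (x + y) * t + x * y := by
    have : (x - y) * (x + y - (t ^ 2 - (x + y) * t + x * y)) = 0 := by
      linear_combination h₁' - h₂'
    exact sub_eq_zero.1 ((mul_eq_zero.1 this).resolve_left (sub_ne_zero.2 h.ne))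
  refine ⟨e₁, ?_⟩
  have e₂ : -(x * y) = (1 - (x + y) + x * y) / dRho := by
    linear_combination h₁' - x * e₁
  rw [e₂, div_mul_cancel₀ _ hd]

end RhoFrame.IsSpectrum

theorem RhoFrame.partialTrace_e_rho (F : H.RhoFrame) :
    partialTrace H.selfDual (F.e rho) = 𝟙 _ := by
  rw [F.e_rho, partialTrace_merge_split, F.split_merge]

theorem RhoFrame.exists_partialTrace (F : H.RhoFrame) (c : H3Label) :
    ∃ k : ℂ, partialTrace H.selfDual (F.e c) = k • 𝟙 _ :=
  have := H.simple_obj rho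
  exists_smul_id _

/-- This expresses the partial trace through idempotents alone, a form that can be transported by
crossing with α. -/
theorem RhoFrame.sandwich (F : H.RhoFrame) {f : H.obj rho ⊗ H.obj rho ⟶ H.obj rho ⊗ H.obj rho}
    {k : ℂ} (hf : partialTrace H.selfDual f = k • 𝟙 _) :
    H.obj rho ◁ F.e one ≫ endApp f (H.obj rho) ≫ H.obj rho ◁ F.e one =
      ((dRho : ℂ)⁻¹ * k) • H.obj rho ◁ F.e one := by
  have h : H.obj rho ◁ cup H.selfDual ≫ endApp f (H.obj rho) ≫ H.obj rho ◁ cap H.selfDual =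
      k • 𝟙 _ := by
    calc _ = (ρ_ (H.obj rho)).hom ≫ partialTrace H.selfDual f ≫ (ρ_ (H.obj rho)).inv := by
          simp [partialTrace]
      _ = k • 𝟙 _ := by
          rw [hf, Linear.smul_comp, Linear.comp_smul, Category.id_comp, Iso.hom_inv_id]
  have he : F.e one = (dRho : ℂ)⁻¹ • (cap H.selfDual ≫ cup H.selfDual) := F.q_w_one
  rw [he]
  simp only [MonoidalLinear.whiskerLeft_smul, whiskerLeft_comp, Linear.smul_comp, Linear.comp_smul,
    Category.assoc]
  rw [reassoc_of% h, Linear.smul_comp, Linear.comp_smul, Category.id_comp, mul_smul,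
    smul_comm k (dRho : ℂ)⁻¹]

/-- Crossing with α fixes the unit idempotent on the last two strands and twists `F.e c` on the
first two, so it carries one sandwich to the other. -/
theorem RhoFrame.partialTrace_twist (F : H.RhoFrame) {c : H3Label} (hc : c ∈ fusion rho rho) :
    partialTrace H.selfDual (F.e (twist 1 c)) = partialTrace H.selfDual (F.e c) := by
  obtain ⟨i, hp, hq⟩ := F.exists_cross
  obtain ⟨k, hk⟩ := F.exists_partialTrace c
  obtain ⟨k', hk'⟩ := F.exists_partialTrace (twist 1 c)
  have m₀ : one ∈ fusion rho rho := by decide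
  have hq₀ : H.obj (pow 1) ◁ H.obj rho ◁ F.e one ≫ i.hom =
      i.hom ≫ (H.obj rho ◁ F.e one) ▷ H.obj (pow 2) := hq one m₀
  have h : H.obj (pow 1) ◁ (H.obj rho ◁ F.e one ≫ endApp (F.e c) (H.obj rho) ≫
      H.obj rho ◁ F.e one) ≫ i.hom =
      i.hom ≫ (H.obj rho ◁ F.e one ≫ endApp (F.e (twist 1 c)) (H.obj rho) ≫
        H.obj rho ◁ F.e one) ▷ H.obj (pow 2) := by
    rw [whiskerLeft_comp, whiskerLeft_comp, Category.assoc, Category.assoc, hq₀,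
      reassoc_of% (hp c hc), reassoc_of% hq₀, comp_whiskerRight, comp_whiskerRight]
  rw [F.sandwich hk, F.sandwich hk', MonoidalLinear.whiskerLeft_smul,
    MonoidalLinear.smul_whiskerRight, Linear.smul_comp, Linear.comp_smul, hq₀] at h
  have hne : i.hom ≫ (H.obj rho ◁ F.e one) ▷ H.obj (pow 2) ≠ 0 := by
    intro h0
    have h1 : (H.obj rho ◁ F.e one) ▷ H.obj (pow 2) = 0 := by
      rw [← cancel_epi i.hom, h0, comp_zero]
    have := H.isEquivalence_tensorRight_pow 2
    have h2 : H.obj rho ◁ F.e one = 0 := by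
      apply (tensorRight (H.obj (pow 2))).map_injective
      change _ ▷ _ = _ ▷ _
      rw [h1, MonoidalPreadditive.zero_whiskerRight]
    have h3 : 𝟙 (H.obj rho ⊗ H.obj one) = 0 := by
      calc 𝟙 (H.obj rho ⊗ H.obj one) = H.obj rho ◁ F.w one ≫ H.obj rho ◁ F.e one ≫
            H.obj rho ◁ F.q one := by
            rw [← whiskerLeft_comp, ← whiskerLeft_comp, ← Category.assoc, F.w_comp_e m₀,
              if_pos rfl, F.w_q _ m₀, whiskerLeft_id]
        _ = 0 := by rw [h2]; simp
    obtain ⟨j⟩ := H.tensor_iso (a := rho) (b := one) (c := rho) (by decide)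
    apply H.id_ne_zero rho
    calc 𝟙 (H.obj rho) = j.inv ≫ 𝟙 _ ≫ j.hom := by simp
      _ = 0 := by rw [h3]; simp
  have hkk := smul_left_injective ℂ hne h
  have : k = k' := mul_left_cancel₀ (inv_ne_zero dRho_ne_zero) hkk
  rw [hk, hk', this]

/-- The partial trace of the ladder contains a lollipop and is zero. The idempotent of 1 has partial
trace 1/d, that of ρ has the bigon value 1, and twisting carries this value to αρ and α*ρ. -/
theorem RhoFrame.IsSpectrum.trace_relation {F : H.RhoFrame} (h : F.IsSpectrum H t x y) :
    (dRho : ℂ)⁻¹ + (t + (x + y)) = 0 := by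
  have h₂ : partialTrace H.selfDual (F.e (powRho 2)) = 𝟙 _ :=
    (F.partialTrace_twist (c := rho) (by decide)).trans F.partialTrace_e_rho
  have h₁ : partialTrace H.selfDual (F.e (powRho 1)) = 𝟙 _ :=
    (F.partialTrace_twist (c := powRho 2) (by decide)).trans h₂
  have hl : partialTrace H.selfDual (ladder H.selfDual H.vertex) = 0 := by
    rw [partialTrace_ladder, splitApp, capApp]
    simp only [Category.assoc, Iso.hom_inv_id_assoc]
    rw [← comp_whiskerRight_assoc, H.rho_to_unit_eq_zero (_ ≫ _)]
    simp
  have he : F.e H3Label.one = (dRho : ℂ)⁻¹ • (cap H.selfDual ≫ cup H.selfDual) := F.q_w_one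
  rw [h.ladder_eq, partialTrace_add, partialTrace_add, partialTrace_add, partialTrace_smul,
    partialTrace_smul, partialTrace_smul, he, partialTrace_smul, partialTrace_cap_cup, h₁, h₂,
    F.partialTrace_e_rho, ← add_smul, ← add_smul, ← add_smul] at hl
  exact (smul_eq_zero.1 hl).resolve_right (H.id_ne_zero rho)

end H3Structure

end Eigenvalues

/-! ### The polynomial system of the multiplicity space and its inconsistency. -/

/-- Two resolutions of the identity into three idempotents, which are permuted cyclically in
opposite directions by an injective linear map. -/
theorem exists_cyclic_coefficients {V : Type*} [AddCommGroup V] [Module ℂ V] (T : V →ₗ[ℂ] V)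
    (hT : Function.Injective T) (P Q : ZMod 3 → V →ₗ[ℂ] V) {e g : V} {t x y : ℂ} (he : e ≠ 0)
    (hP : ∀ w, P 0 w + (P 1 w + P 2 w) = w) (hQ : ∀ w, Q 0 w + (Q 1 w + Q 2 w) = w)
    (hPP : ∀ i j w, i ≠ j → P j (P i w) = 0)
    (hTP : ∀ i w, T (P i w) = P (i + 2) (T w)) (hTQ : ∀ i w, T (Q i w) = Q (i + 1) (T w))
    (hP₀ : ∀ w, ∃ c : ℂ, P 0 w = c • e) (hQ₀ : ∀ w, ∃ c : ℂ, Q 0 w = c • g)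
    (hPe : P 0 e = e) (hPg : P 0 g = x • e) (hQe : Q 0 e = x • g)
    (hf : t • P 0 g + (x • P 1 g + y • P 2 g) = t • Q 0 e + (x • Q 1 e + y • Q 2 e)) :
    ∃ l A₁ A₂ B₁ B₂ : ℂ, 1 = x ^ 2 + l * (A₁ * B₁ + A₂ * B₂) ∧
      0 = x * B₁ + A₁ * B₂ + x * A₂ ∧ 0 = x * B₂ + x * A₁ + l * A₂ * B₁ ∧
      x * B₁ = t * x * B₁ + x * A₁ * B₂ + y * x * A₂ ∧
      y * B₂ = t * x * B₂ + x * x * A₁ + y * l * A₂ * B₁ := by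
  have z12 : (1 : ZMod 3) + 2 = 0 := by decide
  have z22 : (2 : ZMod 3) + 2 = 1 := by decide
  have z21 : (2 : ZMod 3) + 1 = 0 := by decide
  have z11 : (1 : ZMod 3) + 1 = 2 := by decide
  have hTe : P 2 (T e) = T e := by
    conv_rhs => rw [← hPe, hTP, zero_add]
  have hTTe : P 1 (T (T e)) = T (T e) := by
    conv_rhs => rw [← hTe, hTP, z22]
  -- The cube of `T` preserves the index of `P`, hence the line spanned by `e`.
  obtain ⟨l, hl⟩ : ∃ l : ℂ, T (T (T e)) = l • e := by
    obtain ⟨l, hl⟩ := hP₀ (T (T (T e)))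
    exact ⟨l, by rw [← hl, ← z12, ← hTP, hTTe]⟩
  have hl0 : l ≠ 0 := by
    rintro rfl
    rw [zero_smul] at hl
    have h0 : ∀ w, T w = 0 → w = 0 := fun w h => hT (h.trans (map_zero T).symm)
    exact he (h0 _ (h0 _ (h0 _ hl)))
  -- `T` carries the image of `P 1` into the line of `e`; writing `e` as `T (T (T e))` divided by
  -- `l` and cancelling `T` gives the coefficient.
  obtain ⟨B₁, hB₁⟩ : ∃ B : ℂ, P 1 g = B • T (T e) := by
    obtain ⟨c, hc⟩ := hP₀ (T g)
    refine ⟨c / l, hT ?_⟩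
    rw [hTP, z12, hc, map_smul, hl, smul_smul, div_mul_cancel₀ _ hl0]
  obtain ⟨B₂, hB₂⟩ : ∃ B : ℂ, P 2 g = B • T e := by
    obtain ⟨c, hc⟩ := hP₀ (T (T g))
    refine ⟨c / l, hT (hT ?_)⟩
    rw [hTP, z22, hTP, z12, hc, map_smul, map_smul, hl, smul_smul, div_mul_cancel₀ _ hl0]
  have hg : g = x • e + (B₁ • T (T e) + B₂ • T e) := by
    conv_lhs => rw [← hP g, hPg, hB₁, hB₂]
  have hTg : T g = x • T e + ((B₁ * l) • e + B₂ • T (T e)) := by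
    conv_lhs => rw [hg]
    simp only [map_add, map_smul, hl, smul_smul]
  have hTTg : T (T g) = x • T (T e) + ((B₁ * l) • T e + (B₂ * l) • e) := by
    rw [hTg]
    simp only [map_add, map_smul, hl, smul_smul]
  have hTTTg : T (T (T g)) = l • g := by
    rw [hTTg]
    conv_rhs => rw [hg]
    simp only [map_add, map_smul, hl, smul_smul, smul_add]
    module
  obtain ⟨A₁, hA₁⟩ : ∃ A : ℂ, Q 1 e = A • T g := by
    obtain ⟨c, hc⟩ := hQ₀ (T (T e))
    refine ⟨c / l, hT (hT ?_)⟩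
    rw [hTQ, z11, hTQ, z21, hc, map_smul, map_smul, hTTTg, smul_smul, div_mul_cancel₀ _ hl0]
  obtain ⟨A₂, hA₂⟩ : ∃ A : ℂ, Q 2 e = A • T (T g) := by
    obtain ⟨c, hc⟩ := hQ₀ (T e)
    refine ⟨c / l, hT ?_⟩
    rw [hTQ, z21, hc, map_smul, hTTTg, smul_smul, div_mul_cancel₀ _ hl0]
  have hTe0 : T e ≠ 0 := fun h => he (hT (h.trans (map_zero T).symm))
  have hTTe0 : T (T e) ≠ 0 := fun h => hTe0 (hT (h.trans (map_zero T).symm))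
  -- The three vectors lie in the images of `P 0`, `P 1` and `P 2`, so coordinates can be compared.
  have indep : ∀ a b c a' b' c' : ℂ, a • e + (b • T (T e) + c • T e) =
      a' • e + (b' • T (T e) + c' • T e) → a = a' ∧ b = b' ∧ c = c' := by
    intro a b c a' b' c' h
    have hz : ∀ i, i ≠ 0 → P i e = 0 := fun i hi => by
      conv_lhs => rw [← hPe, hPP 0 i e (Ne.symm hi)]
    have hz' : ∀ i, i ≠ 2 → P i (T e) = 0 := fun i hi => by
      conv_lhs => rw [← hTe, hPP 2 i _ (Ne.symm hi)]
    have hz'' : ∀ i, i ≠ 1 → P i (T (T e)) = 0 := fun i hi => by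
      conv_lhs => rw [← hTTe, hPP 1 i _ (Ne.symm hi)]
    have h₀ := congrArg (P 0) h
    have h₁ := congrArg (P 1) h
    have h₂ := congrArg (P 2) h
    simp only [map_add, map_smul, hPe, hTe, hTTe, hz' 0 (by decide), hz'' 0 (by decide),
      hz 1 (by decide), hz' 1 (by decide), hz 2 (by decide), hz'' 2 (by decide), smul_zero,
      add_zero, zero_add] at h₀ h₁ h₂
    exact ⟨smul_left_injective ℂ he h₀, smul_left_injective ℂ hTTe0 h₁,
      smul_left_injective ℂ hTe0 h₂⟩
  have E₁ : e = x • g + (A₁ • T g + A₂ • T (T g)) := by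
    conv_lhs => rw [← hQ e, hQe, hA₁, hA₂]
  have E₂ := hf
  rw [hPg, hB₁, hB₂, hQe, hA₁, hA₂, hTTg, hTg, hg] at E₂
  rw [hTTg, hTg, hg] at E₁
  obtain ⟨a₁, a₂, a₃⟩ := indep 1 0 0 (x * x + A₁ * (B₁ * l) + A₂ * (B₂ * l))
    (x * B₁ + A₁ * B₂ + A₂ * x) (x * B₂ + A₁ * x + A₂ * (B₁ * l)) (by
      rw [one_smul, zero_smul, zero_smul, add_zero, add_zero]
      refine E₁.trans ?_
      module)
  -- Only two coordinates of the ladder relation are needed for the contradiction.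
  obtain ⟨-, b₂, b₃⟩ := indep (t * x) (x * B₁) (y * B₂)
    (t * (x * x) + x * (A₁ * (B₁ * l)) + y * (A₂ * (B₂ * l)))
    (t * (x * B₁) + x * (A₁ * B₂) + y * (A₂ * x))
    (t * (x * B₂) + x * (A₁ * x) + y * (A₂ * (B₁ * l))) (by
      refine Eq.trans ?_ (E₂.trans ?_) <;> module)
  exact ⟨l, A₁, A₂, B₁, B₂, by linear_combination a₁, by linear_combination a₂,
    by linear_combination a₃, by linear_combination b₂, by linear_combination b₃⟩

/-- The equations are linear in B₁ and B₂. Eliminating these leaves three monomial relations between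
A₁, A₂ and l, and their combination is a condition on x and y alone. -/
theorem cyclic_coefficients_false {s x y l A₁ A₂ B₁ B₂ : ℂ} (hs : s ^ 2 = 3 * s + 1)
    (hadd : x + y = s) (hmul : x * y = s) (h₁ : 1 = x ^ 2 + l * (A₁ * B₁ + A₂ * B₂))
    (h₂ : 0 = x * B₁ + A₁ * B₂ + x * A₂) (h₃ : 0 = x * B₂ + x * A₁ + l * A₂ * B₁)
    (h₄ : x * B₁ = x * A₁ * B₂ + y * x * A₂)
    (h₅ : y * B₂ = x * x * A₁ + y * l * A₂ * B₁) : False := by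
  have hs0 : s ≠ 0 := by rintro rfl; norm_num at hs
  have hx : x ≠ 0 := by rintro rfl; exact hs0 (by linear_combination -hmul)
  have hy : y ≠ 0 := by rintro rfl; exact hs0 (by linear_combination -hmul)
  have hx1 : 1 + x ≠ 0 := by
    intro h
    have h2 : 2 * s = -1 := by
      have : x = -1 := by linear_combination h
      subst this
      linear_combination -hmul - hadd
    have : (4 : ℂ) * (s ^ 2 - 3 * s - 1) = 3 := by
      linear_combination (2 * s - 7) * h2
    rw [hs] at this
    norm_num at this
  have hxm : 1 - x ≠ 0 := by
    intro h
    have : x = 1 := by linear_combination -h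
    subst this
    have : (1 : ℂ) = 0 := by linear_combination hadd - hmul
    exact one_ne_zero this
  have c₁ : (1 + x) * B₁ = (y - x) * A₂ := by
    apply mul_left_cancel₀ hx
    linear_combination h₄ - x * h₂
  have c₂ : y * (1 + x) * B₂ = x * (x - y) * A₁ := by
    linear_combination h₅ - y * h₃
  have b' : y * (1 + y) * A₂ = (y - x) * A₁ ^ 2 := by
    apply mul_left_cancel₀ hx
    linear_combination (-y) * (1 + x) * h₂ - x * y * c₁ - A₁ * c₂
  have c' : A₁ * x * (y + x ^ 2) = -l * y * (y - x) * A₂ ^ 2 := by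
    linear_combination (-y) * (1 + x) * h₃ - x * c₂ - l * y * A₂ * c₁
  have a' : y * (1 - x ^ 2) * (1 + x) = l * (y - x) ^ 2 * A₁ * A₂ := by
    linear_combination y * (1 + x) * h₁ + l * y * A₁ * c₁ + l * A₂ * c₂
  have hA₂ : A₂ ≠ 0 := by
    rintro rfl
    have : y * ((1 - x) * (1 + x)) * (1 + x) = 0 := by linear_combination a'
    exact mul_ne_zero (mul_ne_zero hy (mul_ne_zero hxm hx1)) hx1 this
  -- The product of the relations `b'` and `c'` contains l A₁ A₂, which `a'` evaluates.
  have key : x * (y + x ^ 2) * (1 + y) + y * (1 - x ^ 2) * (1 + x) = 0 := by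
    have : (y * A₂) * (x * (y + x ^ 2) * (1 + y) + y * (1 - x ^ 2) * (1 + x)) = 0 := by
      linear_combination x * (y + x ^ 2) * b' + (y - x) * A₁ * c' + y * A₂ * a'
    exact (mul_eq_zero.1 this).resolve_left (mul_ne_zero hy hA₂)
  have hy' : y = s - x := by linear_combination hadd
  subst hy'
  have hxx : x ^ 2 = s * x - s := by linear_combination -hmul
  -- The polynomial `key` reduces to 3s modulo x² = s x − s and s² = 3s + 1.
  have : 3 * s = 0 := by
    linear_combination key - (3 * x - 2) * hxx - x * hs
  exact hs0 (by linear_combination this / 3)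

/-! ### Determination of the eigenvalue on ρ. -/

section Eigenvalues

set_option linter.unusedSectionVars false

variable {C : Type u} [Category.{v} C] [Abelian C] [Linear ℂ C] [MonoidalCategory C]
  [MonoidalPreadditive C] [MonoidalLinear ℂ C] [RigidCategory C] [IsFusionCategory C]

namespace H3Structure

open H3Label

variable {H : H3Structure C}

theorem RhoFrame.splitApp_mergeApp (F : H.RhoFrame) (W : C) :
    splitApp H.selfDual H.vertex W ≫ mergeApp H.selfDual H.vertex W = 𝟙 _ := by
  simp only [splitApp, mergeApp, Category.assoc, Iso.hom_inv_id_assoc]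
  rw [← comp_whiskerRight, F.split_merge, id_whiskerRight]

variable (H) in
theorem hom_tensor_one_eq_zero {a : H3Label} (ha : a ≠ rho) (f : H.obj a ⟶ H.obj rho ⊗ 𝟙_ C) :
    f = 0 :=
  H.hom_eq_zero_of_iso ha ⟨Iso.refl _⟩ ⟨ρ_ _⟩ f

variable {t x y : ℂ} {F : H.RhoFrame}

theorem dRho_sq : (dRho : ℂ) ^ 2 = 3 * dRho + 1 := by
  have : dRho ^ 2 = 3 * dRho + 1 := by
    unfold dRho
    linear_combination (1 / 4) * Real.sq_sqrt (by norm_num : (0 : ℝ) ≤ 13)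
  exact_mod_cast this

namespace RhoFrame.IsSpectrum

/-- The multiplicity space of `αρ` in `ρ ⊗ ρ ⊗ ρ`, with the idempotents of the first two and of the
last two strands and conjugation by `α`. -/
theorem exists_coefficients (h : F.IsSpectrum H t x y) :
    ∃ l A₁ A₂ B₁ B₂ : ℂ, 1 = x ^ 2 + l * (A₁ * B₁ + A₂ * B₂) ∧
      0 = x * B₁ + A₁ * B₂ + x * A₂ ∧ 0 = x * B₂ + x * A₁ + l * A₂ * B₁ ∧
      x * B₁ = t * x * B₁ + x * A₁ * B₂ + y * x * A₂ ∧
      y * B₂ = t * x * B₂ + x * x * A₁ + y * l * A₂ * B₁ := by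
  obtain ⟨T, hT, hT₁, hT₂⟩ := F.exists_conj
  have hmem : ∀ k, powRho k ∈ fusion rho rho := fun k => mem_fusion_rho_rho.2 (Or.inr ⟨k, rfl⟩)
  have m₁ := hmem 1
  have hv := F.w_ne_zero m₁
  have hl := _root_.ladder_eq H.rotateVertex_vertex
  have hsR : splitApp H.selfDual H.vertex (H.obj rho) ≫ H.obj rho ◁ mergeVertex H.selfDual H.vertex
      = ladder H.selfDual H.vertex := by
    simp [splitApp, ladder]
  -- The source αρ admits no unit channel, so exactly the three channels permuted by α remain; the
  -- source ρ would have a fourth.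
  have hone : ∀ w : H.obj (powRho 1) ⟶ H.obj rho ⊗ (H.obj rho ⊗ H.obj rho),
      w ≫ endApp (F.e H3Label.one) (H.obj rho) = 0 := by
    intro w
    have he : F.e H3Label.one = (dRho : ℂ)⁻¹ • (cap H.selfDual ≫ cup H.selfDual) := F.q_w_one
    rw [he, endApp_smul, endApp_cap_cup, Linear.comp_smul, ← Category.assoc,
      H.hom_eq_zero (by decide) (w ≫ capApp H.selfDual (H.obj rho)), zero_comp, smul_zero]
  have hone' : ∀ w : H.obj (powRho 1) ⟶ H.obj rho ⊗ (H.obj rho ⊗ H.obj rho),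
      w ≫ H.obj rho ◁ F.e H3Label.one = 0 := by
    intro w
    have he : F.e H3Label.one = (dRho : ℂ)⁻¹ • (cap H.selfDual ≫ cup H.selfDual) := F.q_w_one
    rw [he, MonoidalLinear.whiskerLeft_smul, whiskerLeft_comp, Linear.comp_smul, ← Category.assoc,
      H.hom_tensor_one_eq_zero (by decide) (w ≫ H.obj rho ◁ cap H.selfDual), zero_comp, smul_zero]
  refine exists_cyclic_coefficients T hT
    (fun k => Linear.rightComp ℂ _ (endApp (F.e (powRho k)) (H.obj rho)))
    (fun k => Linear.rightComp ℂ _ (H.obj rho ◁ F.e (powRho k)))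
    (e := F.w (powRho 1) ≫ splitApp H.selfDual H.vertex (H.obj rho))
    (g := F.w (powRho 1) ≫ H.obj rho ◁ splitVertex H.selfDual H.vertex)
    ?_ ?_ ?_ ?_ ?_ ?_ ?_ ?_ ?_ ?_ ?_ ?_ <;> try simp only [Linear.rightComp_apply]
  · intro h0
    apply hv
    rw [← Category.comp_id (F.w _), ← F.splitApp_mergeApp, reassoc_of% h0, zero_comp]
  · intro w
    calc _ = w ≫ endApp (F.e H3Label.one + (F.e (powRho 0) + (F.e (powRho 1) + F.e (powRho 2))))
          (H.obj rho) := by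
          simp only [endApp_add, Preadditive.comp_add, hone, zero_add]
      _ = w := by rw [F.sum_e, endApp_id, Category.comp_id]
  · intro w
    calc _ = w ≫ H.obj rho ◁ (F.e H3Label.one +
          (F.e (powRho 0) + (F.e (powRho 1) + F.e (powRho 2)))) := by
          simp only [MonoidalPreadditive.whiskerLeft_add, Preadditive.comp_add, hone', zero_add]
      _ = w := by rw [F.sum_e, whiskerLeft_id, Category.comp_id]
  · intro i j w hij
    rw [Category.assoc, ← endApp_comp, F.e_comp_e (hmem i), if_neg (by simpa using hij)]
    simp [endApp]
  · intro i w
    rw [hT₁ _ (hmem i)]; rfl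
  · intro i w
    rw [hT₂ _ (hmem i)]
    have : twist 2 (powRho i) = powRho (i + 1) := rfl
    rw [this]
  · intro w
    obtain ⟨c, hc⟩ := H.exists_eq_smul m₁ hv (w ≫ mergeApp H.selfDual H.vertex (H.obj rho))
    exact ⟨c, by rw [F.e_rho, endApp_merge_split, reassoc_of% hc, Linear.smul_comp]⟩
  · intro w
    obtain ⟨c, hc⟩ := H.exists_eq_smul m₁ hv (w ≫ H.obj rho ◁ mergeVertex H.selfDual H.vertex)
    exact ⟨c, by rw [F.e_rho, whiskerLeft_comp, reassoc_of% hc, Linear.smul_comp]⟩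
  · rw [F.e_rho, endApp_merge_split, Category.assoc, reassoc_of% (F.splitApp_mergeApp (H.obj rho))]
  · rw [F.e_rho, endApp_merge_split, Category.assoc, ← reassoc_of% hl,
      reassoc_of% h.one, Linear.smul_comp]
  · rw [F.e_rho, whiskerLeft_comp, Category.assoc, reassoc_of% hsR, reassoc_of% h.one,
      Linear.smul_comp]
  -- Both sides are one diagram: the two strands of αρ → ρ ⊗ ρ split, and the two inner branches
  -- merge.
  · calc _ = (F.w (powRho 1) ≫ H.obj rho ◁ splitVertex H.selfDual H.vertex) ≫
          endApp (ladder H.selfDual H.vertex) (H.obj rho) := by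
          rw [h.ladder_eq]
          simp only [endApp_add, endApp_smul, Preadditive.comp_add, Linear.comp_smul, hone,
            zero_add]
      _ = (F.w (powRho 1) ≫ splitApp H.selfDual H.vertex (H.obj rho)) ≫
          H.obj rho ◁ ladder H.selfDual H.vertex := by
          rw [endApp_ladder, ladderApp, Category.assoc, Category.assoc,
            ← reassoc_of% (splitApp_naturality H.selfDual H.vertex
              (splitVertex H.selfDual H.vertex)), ← whiskerLeft_comp, ← hl]
      _ = _ := by
          rw [h.ladder_eq]
          simp only [MonoidalPreadditive.whiskerLeft_add, MonoidalLinear.whiskerLeft_smul,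
            Preadditive.comp_add, Linear.comp_smul, hone', zero_add]

/-- The product xy is eliminated between the two square relations and x + y by the trace relation;
d² = 3d + 1 then removes the constant term. -/
theorem mul_relation (h : F.IsSpectrum H t x y) :
    t * (4 * dRho + 2 + (8 * dRho + 2) * t) = 0 := by
  obtain ⟨h₁, h₂⟩ := h.square_relations
  have h₃ := h.trace_relation
  have hd := dRho_ne_zero
  have h₄ : 1 + dRho * (t + (x + y)) = 0 := by
    field_simp at h₃
    linear_combination h₃
  linear_combination (-dRho) * ((1 + dRho) * h₁ - h₂) + ((1 + dRho) * (1 + t) - 1) * h₄ -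
    t * (1 + 2 * t) * dRho_sq

/-- At t = 0 the relations reduce to x + y = xy = −1/d, and −1/d is the second root of s² = 3s + 1.
They are consistent, so the contradiction has to come from the multiplicity space. -/
theorem ne_zero (h : F.IsSpectrum H t x y) : t ≠ 0 := by
  rintro rfl
  obtain ⟨l, A₁, A₂, B₁, B₂, e₁, e₂, e₃, e₄, e₅⟩ := h.exists_coefficients
  obtain ⟨h₁, h₂⟩ := h.square_relations
  have h₃ := h.trace_relation
  have hd := dRho_ne_zero
  have h₄ : 1 + dRho * (x + y) = 0 := by
    field_simp at h₃
    linear_combination h₃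
  refine cyclic_coefficients_false (s := x + y) ?_ rfl ?_ e₁ e₂ e₃ ?_ ?_
  · have := dRho_sq
    have hd2 : (dRho : ℂ) ^ 2 ≠ 0 := pow_ne_zero 2 hd
    apply mul_left_cancel₀ hd2
    linear_combination (dRho * (x + y) - 1 - 3 * dRho) * h₄ - this
  · linear_combination -h₁
  · linear_combination e₄
  · linear_combination e₅

theorem eq_value (h : F.IsSpectrum H t x y) : t = -(2 / 3) * dRho + 5 / 3 := by
  have h₁ := (mul_eq_zero.1 h.mul_relation).resolve_left h.ne_zero
  have hs := dRho_sq
  have hp : (8 * dRho + 2 : ℂ) ≠ 0 := by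
    have : (8 * dRho + 2 : ℝ) > 0 := by unfold dRho; positivity
    exact_mod_cast this.ne'
  apply mul_left_cancel₀ hp
  linear_combination h₁ + (16 / 3) * hs

end RhoFrame.IsSpectrum

end H3Structure

end Eigenvalues

/-! ### Homogeneity in the vertex. -/

section Scaling

set_option linter.unusedSectionVars false

variable {C : Type u} [Category.{v} C] [MonoidalCategory C] [Preadditive C] [Linear ℂ C]
  [MonoidalPreadditive C] [MonoidalLinear ℂ C] {X : C} (p : ExactPairing X X)
  (c : ℂ) (τ : 𝟙_ C ⟶ X ⊗ (X ⊗ X))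

theorem splitVertex_smul : splitVertex p (c • τ) = c • splitVertex p τ := by
  simp [splitVertex]

theorem mergeVertex_smul : mergeVertex p (c • τ) = c • mergeVertex p τ := by
  simp [mergeVertex, splitVertex_smul]

theorem rotateVertex_smul : rotateVertex p (c • τ) = c • rotateVertex p τ := by
  simp [rotateVertex, splitVertex_smul]

theorem bigonDiagram_smul : bigonDiagram p (c • τ) = (c * c) • bigonDiagram p τ := by
  simp [bigonDiagram, splitVertex_smul, mergeVertex_smul, smul_smul]

theorem ladder_smul : ladder p (c • τ) = (c * c) • ladder p τ := by
  simp [ladder, splitVertex_smul, mergeVertex_smul, smul_smul]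

variable {p c τ}

theorem IsDiagramSum.smul_vertex (hc : c ≠ 0) {A B : TensorWord} {f : A.eval X ⟶ B.eval X}
    (h : IsDiagramSum p τ A B f) : IsDiagramSum p (c • τ) A B f := by
  induction h with
  | cup => exact .cup
  | cap => exact .cap
  | vertex =>
    have h : c⁻¹ • c • τ = τ := by rw [smul_smul, inv_mul_cancel₀ hc, one_smul]
    have h' := IsDiagramSum.smul _ _ c⁻¹ _ (IsDiagramSum.vertex (p := p) (τ := c • τ))
    exact (congrArg (IsDiagramSum p (c • τ) _ _) h).mp h'
  | id A => exact .id A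
  | associator_hom A B D => exact .associator_hom A B D
  | associator_inv A B D => exact .associator_inv A B D
  | leftUnitor_hom A => exact .leftUnitor_hom A
  | leftUnitor_inv A => exact .leftUnitor_inv A
  | rightUnitor_hom A => exact .rightUnitor_hom A
  | rightUnitor_inv A => exact .rightUnitor_inv A
  | comp A B D f g _ _ hf hg => exact .comp _ _ _ _ _ hf hg
  | tensor A B D E f g _ _ hf hg => exact .tensor _ _ _ _ _ _ hf hg
  | add A B f g _ _ hf hg => exact .add _ _ _ _ hf hg
  | smul A B k f _ hf => exact .smul _ _ _ _ hf

theorem splitVertex_ne_zero (hr : rotateVertex p τ = τ) (hτ : τ ≠ 0) : splitVertex p τ ≠ 0 := by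
  intro h
  apply hτ
  rw [← hr, rotateVertex, h]
  simp

theorem mergeVertex_ne_zero (hr : rotateVertex p τ = τ) (hτ : τ ≠ 0) : mergeVertex p τ ≠ 0 := by
  intro h
  apply splitVertex_ne_zero hr hτ
  calc splitVertex p τ = (ρ_ X).inv ≫ splitApp p τ (𝟙_ C) ≫ X ◁ (ρ_ X).hom := by
        simp only [splitApp]; monoidal
    _ = 0 := by rw [splitApp_eq_bend_right, mergeApp, h]; simp

end Scaling

/-! ### Normalisation, F-symbols and the theorem. -/

section Main

set_option linter.unusedSectionVars false

variable {C : Type u} [Category.{v} C] [Abelian C] [Linear ℂ C] [MonoidalCategory C]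
  [MonoidalPreadditive C] [MonoidalLinear ℂ C] [RigidCategory C] [IsFusionCategory C]

namespace H3Structure

open H3Label

variable (H : H3Structure C)

/-- The same structure with the vertex rescaled. -/
def rescale {c : ℂ} (hc : c ≠ 0) : H3Structure C :=
  { H with
    vertex := c • H.vertex
    vertex_ne_zero := smul_ne_zero hc H.vertex_ne_zero
    rotateVertex_vertex := by rw [rotateVertex_smul, H.rotateVertex_vertex]
    generated := fun A B f => (H.generated A B f).smul_vertex hc }

/-- A map ρ ⊗ ρ → ρ is determined by its restriction to the summand ρ. If the bigon vanished, so
would the merging vertex, and with it the original vertex. -/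
theorem exists_bigonDiagram : ∃ b : ℂ, b ≠ 0 ∧ bigonDiagram H.selfDual H.vertex = b • 𝟙 _ := by
  have := H.simple_obj rho
  obtain ⟨b, hb⟩ := exists_smul_id (bigonDiagram H.selfDual H.vertex)
  refine ⟨b, ?_, hb⟩
  obtain ⟨w₀, hw₀⟩ := H.exists_basis rho rho
  let w := Function.update w₀ rho (splitVertex H.selfDual H.vertex)
  have hw_rho : w rho = splitVertex H.selfDual H.vertex := Function.update_self _ _ _
  obtain ⟨q, hq, -⟩ := H.exists_dual rho rho w fun c hc => by
    by_cases h : c = rho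
    · subst h
      rw [hw_rho]
      exact splitVertex_ne_zero H.rotateVertex_vertex H.vertex_ne_zero
    · simp only [w]
      rw [Function.update_of_ne h]
      exact hw₀ c hc
  rintro rfl
  apply mergeVertex_ne_zero H.rotateVertex_vertex H.vertex_ne_zero
  rw [eq_smul_dual hq (by decide : rho ∈ fusion rho rho) (mergeVertex H.selfDual H.vertex)
    (k := 0) (by rw [hw_rho]; exact hb), zero_smul]

theorem splitVertex_ladder_of_bigonDiagram_eq_id (hb : bigonDiagram H.selfDual H.vertex = 𝟙 _) :
    splitVertex H.selfDual H.vertex ≫ ladder H.selfDual H.vertex =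
      (-(2 / 3) * dRho + 5 / 3 : ℂ) • splitVertex H.selfDual H.vertex := by
  obtain ⟨F⟩ := exists_frame hb
  obtain ⟨t, ht⟩ := F.exists_eigenvalue 0
  obtain ⟨x, hx⟩ := F.exists_eigenvalue 1
  obtain ⟨y, hy⟩ := F.exists_eigenvalue 2
  have h : F.IsSpectrum H t x y := ⟨ht, hx, hy⟩
  rw [← h.eq_value, ← F.w_rho]
  exact ht

theorem splitVertex_ladder {b : ℂ} (hb : bigonDiagram H.selfDual H.vertex = b • 𝟙 _)
    (hb₀ : b ≠ 0) : splitVertex H.selfDual H.vertex ≫ ladder H.selfDual H.vertex =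
      (b * (-(2 / 3) * dRho + 5 / 3)) • splitVertex H.selfDual H.vertex := by
  obtain ⟨c, hc⟩ := IsAlgClosed.exists_pow_nat_eq b⁻¹ two_pos
  have hc₀ : c ≠ 0 := by
    rintro rfl
    exact inv_ne_zero hb₀ (by rw [← hc]; norm_num)
  have hcb : c * c * b = 1 := by rw [← pow_two, hc, inv_mul_cancel₀ hb₀]
  have h : splitVertex H.selfDual (c • H.vertex) ≫ ladder H.selfDual (c • H.vertex) =
      (-(2 / 3) * dRho + 5 / 3 : ℂ) • splitVertex H.selfDual (c • H.vertex) :=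
    (H.rescale hc₀).splitVertex_ladder_of_bigonDiagram_eq_id
      (show bigonDiagram H.selfDual (c • H.vertex) = 𝟙 (H.obj rho) by
        rw [bigonDiagram_smul, hb, smul_smul, hcb, one_smul])
  rw [splitVertex_smul, ladder_smul, Linear.smul_comp, Linear.comp_smul, smul_smul, smul_smul] at h
  -- The left side of `h` is cubic in `c`, the right side linear; this factor normalises the left
  -- side, as c² b = 1.
  have h' := congrArg (fun f => (c⁻¹ * b) • f) h
  simp only [smul_smul] at h'
  rw [show c⁻¹ * b * (c * (c * c)) = (c⁻¹ * c) * (c * c * b) by ring, inv_mul_cancel₀ hc₀, hcb,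
    one_mul, one_smul] at h'
  rw [h']
  congr 1
  field_simp

theorem exists_isFSymbols {v : ∀ a b c : H3Label, H.obj c ⟶ H.obj a ⊗ H.obj b}
    (hv : H.IsVertexBasis v) : ∃ F, H.IsFSymbols v F := by
  have key : ∀ x y z u k : H3Label, ∃ F : H3Label → ℂ,
      v k z u ≫ v x y k ▷ H.obj z ≫ (α_ (H.obj x) (H.obj y) (H.obj z)).hom =
        ∑ j, F j • (v x j u ≫ H.obj x ◁ v y z j) := by
    intro x y z u k
    set f := v k z u ≫ v x y k ▷ H.obj z ≫ (α_ (H.obj x) (H.obj y) (H.obj z)).hom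
    obtain ⟨q, hq, -⟩ := H.exists_dual y z (v y z) (hv y z)
    have hc : ∀ j, ∃ c : ℂ, f ≫ H.obj x ◁ q j = c • v x j u := by
      intro j
      by_cases hj : u ∈ fusion x j
      · exact H.exists_eq_smul hj (hv x j u hj) _
      · exact ⟨0, by rw [H.hom_tensor_eq_zero hj (f ≫ _), zero_smul]⟩
    choose c hc using hc
    -- The defining sum runs over all six labels, so inadmissible channels receive the coefficient
    -- 0.
    refine ⟨fun j => if j ∈ fusion y z then c j else 0, ?_⟩
    calc f = f ≫ H.obj x ◁ ∑ j ∈ fusion y z, q j ≫ v y z j := by rw [hq]; simp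
      _ = ∑ j ∈ fusion y z, c j • (v x j u ≫ H.obj x ◁ v y z j) := by
          rw [whiskerLeft_sum, Preadditive.comp_sum]
          refine Finset.sum_congr rfl fun j _ => ?_
          rw [whiskerLeft_comp, reassoc_of% (hc j), Linear.smul_comp]
      _ = _ := by simp only [ite_smul, zero_smul, Finset.sum_ite_mem, Finset.univ_inter]
  choose F hF using key
  exact ⟨fun x y z u j k => F x y z u k j, fun x y z u k => hF x y z u k⟩

theorem IsFSymbols.rho_eq {H : H3Structure C}
    {v : ∀ a b c : H3Label, H.obj c ⟶ H.obj a ⊗ H.obj b} (hv : H.IsVertexBasis v)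
    {F : H3Label → H3Label → H3Label → H3Label → H3Label → H3Label → ℂ} (hF : H.IsFSymbols v F) :
    F rho rho rho rho rho rho = -(2 / 3) * dRho + 5 / 3 := by
  have hm : rho ∈ fusion rho rho := by decide
  have hs := splitVertex_ne_zero H.rotateVertex_vertex H.vertex_ne_zero
  obtain ⟨b, hb₀, hb⟩ := H.exists_bigonDiagram
  obtain ⟨l, hl⟩ := H.exists_eq_smul hm hs (v rho rho rho)
  have hl₀ : l ≠ 0 := by
    rintro rfl
    exact hv rho rho rho hm (by rw [hl, zero_smul])
  -- Merging the last two strands kills every channel except ρ by Schur. It turns the left tree into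
  -- a split followed by a ladder and the right tree into a bigon.
  have h := congrArg (· ≫ H.obj rho ◁ mergeVertex H.selfDual H.vertex) (hF rho rho rho rho rho)
  simp only [Preadditive.sum_comp] at h
  rw [Finset.sum_eq_single_of_mem rho (Finset.mem_univ _) (fun j _ hj => by
    rw [Linear.smul_comp, Category.assoc, ← whiskerLeft_comp,
      H.hom_eq_zero hj (v rho rho j ≫ mergeVertex H.selfDual H.vertex)]
    simp), hl] at h
  have hb' : splitVertex H.selfDual H.vertex ≫ mergeVertex H.selfDual H.vertex = b • 𝟙 _ := hb
  have h₁ : ((l • splitVertex H.selfDual H.vertex) ≫ (l • splitVertex H.selfDual H.vertex) ▷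
      H.obj rho ≫ (α_ (H.obj rho) (H.obj rho) (H.obj rho)).hom) ≫
        H.obj rho ◁ mergeVertex H.selfDual H.vertex =
      (l * l * (b * (-(2 / 3) * dRho + 5 / 3))) • splitVertex H.selfDual H.vertex := by
    rw [mul_smul, ← H.splitVertex_ladder hb hb₀]
    simp [ladder, smul_smul]
  have h₂ : (F rho rho rho rho rho rho • ((l • splitVertex H.selfDual H.vertex) ≫
      H.obj rho ◁ (l • splitVertex H.selfDual H.vertex))) ≫
        H.obj rho ◁ mergeVertex H.selfDual H.vertex =
      (l * l * (b * F rho rho rho rho rho rho)) • splitVertex H.selfDual H.vertex := by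
    simp only [MonoidalLinear.whiskerLeft_smul, Linear.smul_comp, Linear.comp_smul, Category.assoc]
    rw [← whiskerLeft_comp, hb', MonoidalLinear.whiskerLeft_smul, whiskerLeft_id, Linear.comp_smul,
      Category.comp_id]
    module
  have h₃ := h₁.symm.trans (h.trans h₂)
  have h₄ := smul_left_injective ℂ hs h₃
  exact (mul_left_cancel₀ hb₀ (mul_left_cancel₀ (mul_ne_zero hl₀ hl₀) h₄)).symm

end H3Structure

theorem sqrt_dRho_ne_zero : ((√dRho : ℝ) : ℂ) ≠ 0 := by
  have : dRho > 0 := by unfold dRho; positivity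
  exact_mod_cast (Real.sqrt_pos.2 this).ne'

theorem tRho_eq : (tRho : ℂ) = ((√dRho : ℝ) : ℂ) * (-(2 / 3) * dRho + 5 / 3) := by
  rw [tRho]; push_cast; ring

end Main

theorem mainTheorem3 {C : Type u} [Category.{v} C] [Abelian C] [Linear ℂ C]
    [MonoidalCategory C] [MonoidalPreadditive C] [MonoidalLinear ℂ C] [RigidCategory C]
    [IsFusionCategory C] (H : H3Structure C) :
    -- the vertex can be normalised so that the bigon has the value `√d_ρ`,
    (∃ c : ℂ, c ≠ 0 ∧ bigonDiagram H.selfDual (c • H.vertex) =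
      ((√dRho : ℝ) : ℂ) • 𝟙 (H.obj H3Label.rho)) ∧
    -- and in this normalisation the triangle popping constant is `t`
    (∀ c : ℂ, bigonDiagram H.selfDual (c • H.vertex) = ((√dRho : ℝ) : ℂ) • 𝟙 (H.obj H3Label.rho) →
      triangleDiagram H.selfDual (c • H.vertex) =
        (tRho : ℂ) • splitVertex H.selfDual (c • H.vertex)) ∧
    -- the `F`-symbols exist, and their entry is `t / √d_ρ`, in every gauge
    (∀ v : ∀ a b c : H3Label, H.obj c ⟶ H.obj a ⊗ H.obj b, H.IsVertexBasis v →
      (∃ F, H.IsFSymbols v F) ∧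
      ∀ F, H.IsFSymbols v F →
        F H3Label.rho H3Label.rho H3Label.rho H3Label.rho H3Label.rho H3Label.rho =
          (tRho : ℂ) / ((√dRho : ℝ) : ℂ)) := by
  refine ⟨?_, fun c hc => ?_, fun v hv => ⟨H.exists_isFSymbols hv, fun F hF => ?_⟩⟩
  · obtain ⟨b, hb₀, hb⟩ := H.exists_bigonDiagram
    obtain ⟨c, hc⟩ := IsAlgClosed.exists_pow_nat_eq (((√dRho : ℝ) : ℂ) / b) two_pos
    refine ⟨c, ?_, ?_⟩
    · rintro rfl
      exact div_ne_zero sqrt_dRho_ne_zero hb₀ (by rw [← hc]; norm_num)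
    · rw [bigonDiagram_smul, hb, smul_smul, ← pow_two, hc, div_mul_cancel₀ _ hb₀]
  · have hc₀ : c ≠ 0 := by
      rintro rfl
      rw [bigonDiagram_smul, zero_mul, zero_smul] at hc
      exact smul_ne_zero sqrt_dRho_ne_zero (H.id_ne_zero _) hc.symm
    rw [tRho_eq]
    exact (triangleDiagram_eq (H.rescale hc₀).rotateVertex_vertex).trans <|
      (H.rescale hc₀).splitVertex_ladder hc sqrt_dRho_ne_zero
  · rw [hF.rho_eq hv, tRho_eq, mul_div_cancel_left₀ _ sqrt_dRho_ne_zero]
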